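/- Let $n\ge 1$ be an integer, and let $g_1,g_2,\dots$ be independent standard Gaussian random vectors in $\mathbb R^n$ on some probability space. For $N\ge n$ let $G=G_N$ be the random $n\times N$ matrix with columns $g_1,\dots,g_N$, let $B_\infty^N=[-1,1]^N$, and let $P_E$ be the orthogonal projection of $\mathbb R^N$ onto the subspace $E=E(N)=\operatorname{Range}(G^*)$, which is almost surely $n$-dimensional. With $|\cdot|$ denoting $n$-dimensional volume, put $$X_N=|G B_\infty^N|,\qquad Y_N=\det(GG^*)^{1/2},\qquad Z_N=|P_E B_\infty^N| .$$ For $p>0$ define $\Delta_{n,p}$ by $\Delta_{n,p}^p=\mathbb E\,|\det[g_1\cdots g_n]|^p$. Then $X_N$, $Y_N^2$ and $Z_N$ are integrable for every $N\ge n$, and there are real random variables $\alpha_{N,n},\beta_{N,n},\delta_{N,n}$ $(N\ge n)$ such that, for every $N\ge n$, almost surely $$\frac{Z_N-\mathbb E Z_N}{N^{\frac{n-1}{2}}}=\alpha_{N,n}\,\frac{X_N-\mathbb E X_N}{N^{n-\frac12}}-\beta_{N,n}\,\frac{Y_N^2-\mathbb E Y_N^2}{N^{n-\frac12}}-\delta_{N,n},$$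 where, as $N\to\infty$, (i) $\alpha_{N,n}\to 1$ almost surely; (ii) $\beta_{N,n}\to \dfrac{2^{n-1}\Delta_{n,1}}{\Delta_{n,2}^2}$ almost surely; (iii) $\delta_{N,n}\to 0$ almost surely. Moreover, for every real $p\ge 1$, $$\sup_{N\ge n+4p-1}\max\bigl(\mathbb E|\alpha_{N,n}|^p,\ \mathbb E|\beta_{N,n}|^p,\ \mathbb E|\delta_{N,n}|^p\bigr)\le C_{n,p},$$ where the constant $C_{n,p}$ depends only on $n$ and $p$. -/

import Mathlib

open MeasureTheory ProbabilityTheory Filter Topology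

noncomputable section

/-- The cube `[-1,1]^N` in Euclidean space `ℝ^N`. -/
def cube (N : ℕ) : Set (EuclideanSpace ℝ (Fin N)) :=
  {x | ∀ i, x i ∈ Set.Icc (-1 : ℝ) 1}

/-- The `n × N` matrix whose columns are the vectors `v 0, …, v (N - 1)` of `ℝ^n`. -/
def colMatrix {n : ℕ} (N : ℕ) (v : ℕ → EuclideanSpace ℝ (Fin n)) :
    Matrix (Fin n) (Fin N) ℝ :=
  Matrix.of fun i j => v j i

/-- `n`-dimensional volume of the image of the cube under the linear map
`A : ℝ^N → ℝ^n`. -/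
def imageVolume {n N : ℕ} (A : Matrix (Fin n) (Fin N) ℝ) : ℝ :=
  (volume (Matrix.toEuclideanLin A '' cube N)).toReal

/-- `det (A A^*)^{1/2}`. -/
def gramRoot {n N : ℕ} (A : Matrix (Fin n) (Fin N) ℝ) : ℝ :=
  Real.sqrt (A * A.transpose).det

/-- `Range (A^*)`, a subspace of `ℝ^N` (of dimension `n` exactly when `A` has rank `n`). -/
def rowSpace {n N : ℕ} (A : Matrix (Fin n) (Fin N) ℝ) :
    Submodule ℝ (EuclideanSpace ℝ (Fin N)) :=
  LinearMap.range (Matrix.toEuclideanLin A.transpose)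

/-- The volume of the orthogonal projection of the cube onto the subspace `E`, for the Lebesgue
measure of the Euclidean space `E` (the `n`-dimensional volume when `dim E = n`). -/
def projectionVolume {N : ℕ} (E : Submodule ℝ (EuclideanSpace ℝ (Fin N))) : ℝ :=
  ((volume : Measure E) (E.orthogonalProjectionOnto '' cube N)).toReal

/-- `X_N = |G B_∞^N|`, where `G` has columns `g 0 ω, …, g (N - 1) ω`. -/
def XN {n : ℕ} {Ω : Type*} (g : ℕ → Ω → EuclideanSpace ℝ (Fin n)) (N : ℕ) (ω : Ω) : ℝ :=
  imageVolume (colMatrix N fun i => g i ω)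

/-- `Y_N = det (G G^*)^{1/2}`. -/
def YN {n : ℕ} {Ω : Type*} (g : ℕ → Ω → EuclideanSpace ℝ (Fin n)) (N : ℕ) (ω : Ω) : ℝ :=
  gramRoot (colMatrix N fun i => g i ω)

/-- `Z_N = |P_E B_∞^N|` with `E = Range (G^*)`. -/
def ZN {n : ℕ} {Ω : Type*} (g : ℕ → Ω → EuclideanSpace ℝ (Fin n)) (N : ℕ) (ω : Ω) : ℝ :=
  projectionVolume (rowSpace (colMatrix N fun i => g i ω))

/-- `Δ_{n,p} = (𝔼 |det [g_1 ⋯ g_n]|^p)^{1/p}` for independent standard Gaussian vectors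
`g_1, …, g_n` in `ℝ^n`. -/
def gaussDet (n : ℕ) (p : ℝ) : ℝ :=
  (∫ v : Fin n → EuclideanSpace ℝ (Fin n),
      |(Matrix.of fun i j => v j i : Matrix (Fin n) (Fin n) ℝ).det| ^ p
    ∂(Measure.pi fun _ => stdGaussian (EuclideanSpace ℝ (Fin n)))) ^ (1 / p)

end

/-!
The expansion holds with the constant coefficients `α = 1` and `β = b`, where
`b = 2^{n-1} Δ_{n,1} / Δ_{n,2}^2`, and with a remainder `δ_N` that is `O(N^{-1/2})` in every `L^p`.
Fixing the coefficients at their limits leaves the whole error to `δ_N`, so this is a sharper form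
of the expansion than one with random coefficients: the fluctuations of `Z_N` are those of a fixed
linear combination of `X_N` and `Y_N^2` up to `O(N^{-1/2})`. Negative moments of `det (G G^*)` do
not enter, and `δ_N → 0` almost surely follows from the fourth moments by Borel–Cantelli.

Everything rests on three exact identities.

* `X_N = Y_N Z_N`, as `G` factors through `P_E` and restricts to an isomorphism of `E` with
  Jacobian `Y_N` (`imageVolume_eq_mul`).
* `X_N = (2^n / n!) ∑ |det [g_{i_1} ⋯ g_{i_n}]|`, the sum being over all `n`-tuples of indices: this
  is the volume formula for zonotopes (`volume_zonotope`), proved by adding one segment at a time.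
* `Y_N^2 = (1 / n!) ∑ det [g_{i_1} ⋯ g_{i_n}]^2`, the Cauchy–Binet formula
  (`det_mul_transpose_eq_sum`).

So `x = X_N / N^n` and `s = Y_N^2 / N^n` are averages over tuples, i.e. U-statistics up to an error
`O(1/N)`, with limiting means `a = 2^n Δ_{n,1} / n! = 2 b` and `1`; here `Δ_{n,2}^2 = n!`. Hoeffding's
representation of a U-statistic as an average, over permutations, of averages of independent blocks
reduces their moments to those of sums of independent centred variables, whence
`𝔼 |x - a|^{2k} + 𝔼 |s - 1|^{2k} = O(N^{-k})` (`exists_moment_tupleAverage_le`).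

Put `z = Z_N / N^{n/2}`. Then `x = √s z`, and `z` is bounded by a constant because the cube lies in
the ball of radius `√N`. These two facts alone give the pointwise second-order estimate
`|z - x + (a / 2) (s - 1)| ≤ K ((x - a)^2 + (s - 1)^2)` (`abs_linear_remainder_le`), without any lower
bound on `s`. Hence `R_N = z - x + b (s - 1)` is `O(1/N)` in every `L^{2k}`
(`exists_moment_remainder_le`), and `δ_N = √N (𝔼 R_N - R_N)` makes the expansion an identity.
-/

/-! ### Sums of determinants over tuples of vectors -/

/-- Splitting off one index: for a symmetric function `F` of `m + 1` indices that vanishes as soon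
as an index is repeated, the index `0` is either absent or occupies exactly one of the `m + 1`
positions. -/
lemma sum_tuples_succ {m N : ℕ} (F : (Fin (m + 1) → Fin (N + 1)) → ℝ)
    (hinj : ∀ i, ¬ Function.Injective i → F i = 0)
    (hperm : ∀ i (σ : Equiv.Perm (Fin (m + 1))), F (i ∘ σ) = F i) :
    ∑ i, F i = ∑ i : Fin (m + 1) → Fin N, F (Fin.succ ∘ i) +
      (m + 1) * ∑ i : Fin m → Fin N, F (Fin.cons 0 (Fin.succ ∘ i)) := by
  have key : ∀ (p : Fin (m + 1)) (i : Fin m → Fin N),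
      F (Fin.cons 0 (Fin.succ ∘ i)) = F (p.insertNth 0 (Fin.succ ∘ i)) := by
    intro p i
    rw [← hperm (Fin.cons 0 (Fin.succ ∘ i)) p.cycleRange]
    congr 1
    ext1 k
    refine Fin.succAboveCases p ?_ (fun j => ?_) k
    · simp
    · simp [Fin.cycleRange_succAbove]
  let e : (Fin (m + 1) → Fin N) ⊕ (Fin (m + 1) × (Fin m → Fin N)) → (Fin (m + 1) → Fin (N + 1)) :=
    Sum.elim (fun i => Fin.succ ∘ i) (fun q => q.1.insertNth 0 (Fin.succ ∘ q.2))
  have he : Function.Injective e := by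
    have hne : ∀ (i : Fin (m + 1) → Fin N) (q : Fin (m + 1) × (Fin m → Fin N)),
        e (Sum.inl i) ≠ e (Sum.inr q) := by
      intro i q h
      have := congrFun h q.1
      simp [e] at this
    rintro (i | ⟨p, i⟩) (j | ⟨q, j⟩) h
    · congr 1
      ext1 k
      exact Fin.succ_injective _ (congrFun h k)
    · exact (hne _ _ h).elim
    · exact (hne _ _ h.symm).elim
    · have hpq : p = q := by
        by_contra hpq
        obtain ⟨r, hr⟩ := Fin.exists_succAbove_eq hpq
        have h' := congrFun h p
        simp only [e, Sum.elim_inr, Fin.insertNth_apply_same] at h'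
        rw [← hr, Fin.insertNth_apply_succAbove] at h'
        exact Fin.succ_ne_zero _ h'.symm
      subst hpq
      congr 2
      ext1 k
      have h' := congrFun h (p.succAbove k)
      simpa [e] using h'
  have hsum := Fintype.sum_of_injective e he (fun x => F (e x)) F ?_ (fun _ => rfl)
  · rw [← hsum, Fintype.sum_sum_type, Fintype.sum_prod_type]
    simp only [e, Sum.elim_inl, Sum.elim_inr, ← key]
    simp
  · intro i hi
    apply hinj
    intro hi'
    apply hi
    by_cases h0 : ∃ p, i p = 0
    · obtain ⟨p, hp⟩ := h0
      have : ∀ k, ∃ j, Fin.succ j = i (p.succAbove k) := by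
        intro k
        apply Fin.exists_succ_eq.2
        rw [← hp]
        exact fun h => Fin.succAbove_ne p k (hi' h)
      choose j hj using this
      refine ⟨Sum.inr (p, j), ?_⟩
      simp only [e, Sum.elim_inr]
      rw [Fin.insertNth_eq_iff]
      refine ⟨hp.symm, ?_⟩
      ext1 k
      exact hj k
    · push Not at h0
      have : ∀ k, ∃ j, Fin.succ j = i k := fun k => Fin.exists_succ_eq.2 (h0 k)
      choose j hj using this
      exact ⟨Sum.inl j, funext hj⟩

/-- The sum of `|det|` over all `n`-tuples of vectors from the family `a`. -/
noncomputable def absDetSum {n N : ℕ} (a : Fin N → Fin n → ℝ) : ℝ :=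
  ∑ i : Fin n → Fin N, |Matrix.det (Matrix.of (a ∘ i))|

lemma absDetSum_nonneg {n N : ℕ} (a : Fin N → Fin n → ℝ) : 0 ≤ absDetSum a :=
  Finset.sum_nonneg fun _ _ => abs_nonneg _

lemma absDetSum_succ {m N : ℕ} (a : Fin (N + 1) → Fin (m + 1) → ℝ) :
    absDetSum a = absDetSum (Fin.tail a) +
      (m + 1) * ∑ i : Fin m → Fin N,
        |Matrix.det (Matrix.of (Fin.cons (a 0) (Fin.tail a ∘ i) : Fin (m + 1) → Fin (m + 1) → ℝ))| := by
  unfold absDetSum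
  rw [sum_tuples_succ]
  · congr 3
    ext1 i
    congr 2
    ext1 k l
    refine Fin.cases ?_ (fun j => ?_) k <;> simp [Fin.tail]
  · intro i hi
    simp only [Function.Injective, not_forall] at hi
    obtain ⟨j, k, hjk, hne⟩ := hi
    rw [Matrix.det_zero_of_row_eq hne (by ext; simp [hjk]), abs_zero]
  · intro i σ
    have := Matrix.det_permute σ (Matrix.of (a ∘ i))
    have h2 : (Matrix.of (a ∘ i)).submatrix σ id = Matrix.of (a ∘ i ∘ σ) := rfl
    rw [← h2, this, abs_mul]
    rcases Int.units_eq_one_or (Equiv.Perm.sign σ) with h | h <;> simp [h]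

lemma det_cons_single {m : ℕ} (B : Fin m → Fin (m + 1) → ℝ) :
    Matrix.det (Matrix.of (Fin.cons (Pi.single 0 1) B : Fin (m + 1) → Fin (m + 1) → ℝ)) =
      Matrix.det (Matrix.of fun k => Fin.tail (B k)) := by
  rw [Matrix.det_succ_row_zero, Fin.sum_univ_succ, Finset.sum_eq_zero]
  · simp only [Fin.val_zero, pow_zero, Matrix.of_apply, Fin.cons_zero, Pi.single_eq_same, add_zero,
      one_mul]
    congr 1
  · intro j _
    simp

/-! ### The volume of a zonotope -/

/-- The zonotope `∑ [-1,1] a_j`. -/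
def zonotope {n N : ℕ} (a : Fin N → Fin n → ℝ) : Set (Fin n → ℝ) :=
  (fun t : Fin N → ℝ => ∑ j, t j • a j) '' Set.Icc (-1) 1

lemma isCompact_zonotope {n N : ℕ} (a : Fin N → Fin n → ℝ) : IsCompact (zonotope a) :=
  isCompact_Icc.image (by fun_prop)

lemma convex_zonotope {n N : ℕ} (a : Fin N → Fin n → ℝ) : Convex ℝ (zonotope a) := by
  have := (convex_Icc (𝕜 := ℝ) (-1 : Fin N → ℝ) 1).linear_image
    (Fintype.linearCombination ℝ a)
  exact this

lemma image_zonotope {n m N : ℕ} (a : Fin N → Fin n → ℝ) (T : (Fin n → ℝ) →ₗ[ℝ] (Fin m → ℝ)) :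
    T '' zonotope a = zonotope fun j => T (a j) := by
  simp [zonotope, Set.image_image]

lemma zonotope_succ {n N : ℕ} (a : Fin (N + 1) → Fin n → ℝ) :
    zonotope a = {x | ∃ t : ℝ, |t| ≤ 1 ∧ x - t • a 0 ∈ zonotope (Fin.tail a)} := by
  ext x
  simp only [zonotope, Set.mem_image, Set.mem_Icc, Set.mem_ofPred_eq, Pi.le_def, Pi.neg_apply,
    Pi.one_apply]
  constructor
  · rintro ⟨t, ⟨h1, h2⟩, rfl⟩
    refine ⟨t 0, abs_le.2 ⟨h1 0, h2 0⟩, Fin.tail t, ⟨fun i => h1 _, fun i => h2 _⟩, ?_⟩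
    rw [Fin.sum_univ_succ, add_sub_cancel_left]
    rfl
  · rintro ⟨t, ht, s, ⟨h1, h2⟩, hs⟩
    rw [abs_le] at ht
    refine ⟨Fin.cons t s, ⟨fun i => ?_, fun i => ?_⟩, ?_⟩
    · refine Fin.cases ht.1 h1 i
    · refine Fin.cases ht.2 h2 i
    · rw [Fin.sum_univ_succ]
      simp only [Fin.cons_zero, Fin.cons_succ]
      rw [eq_sub_iff_add_eq'] at hs
      exact hs

/-- Length of the thickening of a compact interval. -/
lemma volume_thicken_of_convex {K : Set ℝ} (hK : IsCompact K) (hc : Convex ℝ K) :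
    volume {x : ℝ | ∃ t : ℝ, |t| ≤ 1 ∧ x - t ∈ K} =
      volume K + 2 * Set.indicator {_u : Unit | K.Nonempty} 1 () := by
  rcases K.eq_empty_or_nonempty with rfl | hne
  · simp
  have hI := eq_Icc_of_connected_compact ⟨hne, hc.isPreconnected⟩ hK
  have hle : sInf K ≤ sSup K := by
    by_contra h
    rw [hI, Set.Icc_eq_empty h] at hne
    exact Set.not_nonempty_empty hne
  generalize sInf K = l at *
  generalize sSup K = r at *
  have : {x : ℝ | ∃ t : ℝ, |t| ≤ 1 ∧ x - t ∈ K} = Set.Icc (l - 1) (r + 1) := by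
    ext x
    simp only [hI, Set.mem_Icc, Set.mem_ofPred_eq, abs_le]
    constructor
    · rintro ⟨t, ⟨h1, h2⟩, h3, h4⟩
      constructor <;> linarith
    · rintro ⟨h1, h2⟩
      by_cases hx : x ≤ l
      · exact ⟨x - l, ⟨by linarith, by linarith⟩, by linarith, by linarith⟩
      by_cases hx' : x ≤ r
      · exact ⟨0, by simp, by linarith, by linarith⟩
      · exact ⟨x - r, ⟨by linarith, by linarith⟩, by linarith, by linarith⟩
  rw [this, Set.indicator_of_mem (by exact hne), hI, Real.volume_Icc, Real.volume_Icc,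
    Pi.one_apply, mul_one, show (2 : ENNReal) = ENNReal.ofReal 2 by simp,
    ← ENNReal.ofReal_add (by linarith) (by norm_num)]
  congr 1
  ring

/-- Adding the segment `[-e₀, e₀]` to a convex body increases its volume by twice the volume of its
projection along `e₀`: the body is sliced into intervals parallel to `e₀`, and each nonempty one
grows by `2`. -/
lemma volume_add_segment {m : ℕ} {K : Set (Fin (m + 1) → ℝ)} (hK : IsCompact K)
    (hc : Convex ℝ K) :
    volume {x : Fin (m + 1) → ℝ | ∃ t : ℝ, |t| ≤ 1 ∧ x - t • (Pi.single 0 1 : Fin (m + 1) → ℝ) ∈ K} =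
      volume K + 2 * volume (Fin.tail '' K : Set (Fin m → ℝ)) := by
  set K' := {x : Fin (m + 1) → ℝ | ∃ t : ℝ, |t| ≤ 1 ∧ x - t • (Pi.single 0 1 : Fin (m + 1) → ℝ) ∈ K}
  have hK' : IsCompact K' := by
    have : K' = (fun q : ℝ × (Fin (m + 1) → ℝ) => q.2 + q.1 • (Pi.single 0 1 : Fin (m + 1) → ℝ)) ''
        (Set.Icc (-1) 1 ×ˢ K) := by
      ext x
      simp only [K', Set.mem_image, Set.mem_prod, Prod.exists, Set.mem_ofPred_eq, abs_le, Set.mem_Icc]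
      constructor
      · rintro ⟨t, ht, hx⟩
        exact ⟨t, _, ⟨ht, hx⟩, by simp⟩
      · rintro ⟨t, y, ⟨ht, hy⟩, rfl⟩
        exact ⟨t, ht, by simpa using hy⟩
    rw [this]
    exact (isCompact_Icc.prod hK).image (by fun_prop)
  -- slicing formula for the volume of a compact set
  have slice : ∀ S : Set (Fin (m + 1) → ℝ), IsCompact S →
      volume S = ∫⁻ y : Fin m → ℝ, volume {s : ℝ | (Fin.cons s y : Fin (m + 1) → ℝ) ∈ S} := by
    intro S hS
    have hmp := (volume_preserving_piFinSuccAbove (fun _ : Fin (m + 1) => ℝ) 0).symm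
    rw [← hmp.measure_preimage hS.isClosed.measurableSet.nullMeasurableSet, Measure.volume_eq_prod,
      Measure.prod_apply_symm (hmp.measurable hS.isClosed.measurableSet)]
    refine lintegral_congr fun y => congrArg _ (Set.ext fun s => ?_)
    simp [MeasurableEquiv.piFinSuccAbove, Fin.consEquiv]
  have hcons : Continuous fun q : ℝ × (Fin m → ℝ) => (Fin.cons q.1 q.2 : Fin (m + 1) → ℝ) := by
    refine continuous_pi fun i => ?_
    refine Fin.cases ?_ (fun j => ?_) i <;> simp <;> fun_prop
  have himg : IsCompact (Fin.tail '' K : Set (Fin m → ℝ)) :=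
    hK.image (continuous_pi fun i => continuous_apply _)
  rw [slice K' hK', slice K hK]
  have hsec : ∀ y : Fin m → ℝ, volume {s : ℝ | (Fin.cons s y : Fin (m + 1) → ℝ) ∈ K'} =
      volume {s : ℝ | (Fin.cons s y : Fin (m + 1) → ℝ) ∈ K} +
        2 * (Fin.tail '' K : Set (Fin m → ℝ)).indicator 1 y := by
    intro y
    have hcomp : IsCompact {s : ℝ | (Fin.cons s y : Fin (m + 1) → ℝ) ∈ K} := by
      have hcl : IsClosed {s : ℝ | (Fin.cons s y : Fin (m + 1) → ℝ) ∈ K} :=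
        hK.isClosed.preimage (hcons.comp (by fun_prop : Continuous fun s : ℝ => (s, y)))
      refine IsCompact.of_isClosed_subset (hK.image (continuous_apply 0)) hcl ?_
      intro s hs
      exact ⟨_, hs, by simp⟩
    have hconv : Convex ℝ {s : ℝ | (Fin.cons s y : Fin (m + 1) → ℝ) ∈ K} := by
      intro s hs t ht α β hα hβ hαβ
      have := hc hs ht hα hβ hαβ
      simp only [Set.mem_ofPred_eq]
      convert this using 1
      ext i
      refine Fin.cases ?_ (fun j => ?_) i
      · simp
      · simp [← add_mul, hαβ]
    have := volume_thicken_of_convex hcomp hconv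
    convert this using 2
    · ext s
      simp only [K', Set.mem_ofPred_eq]
      refine exists_congr fun t => and_congr_right fun _ => ?_
      have : (Fin.cons s y : Fin (m + 1) → ℝ) - t • (Pi.single 0 1 : Fin (m + 1) → ℝ) = Fin.cons (s - t) y := by
        ext i
        refine Fin.cases ?_ (fun j => ?_) i <;> simp
      rw [this]
    · congr 1
      have hiff : y ∈ (Fin.tail '' K : Set (Fin m → ℝ)) ↔
          {s : ℝ | (Fin.cons s y : Fin (m + 1) → ℝ) ∈ K}.Nonempty := by
        constructor
        · rintro ⟨x, hx, rfl⟩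
          exact ⟨x 0, by simpa using hx⟩
        · rintro ⟨s, hs⟩
          exact ⟨_, hs, by simp⟩
      by_cases hy : y ∈ (Fin.tail '' K : Set (Fin m → ℝ))
      · rw [Set.indicator_of_mem hy, Set.indicator_of_mem (by exact hiff.1 hy)]
        rfl
      · rw [Set.indicator_of_notMem hy, Set.indicator_of_notMem (by exact fun h => hy (hiff.2 h))]
  simp_rw [hsec]
  have hmeas : Measurable ((Fin.tail '' K : Set (Fin m → ℝ)).indicator (1 : (Fin m → ℝ) → ENNReal)) :=
    measurable_one.indicator himg.isClosed.measurableSet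
  rw [lintegral_add_right _ (hmeas.const_mul 2), lintegral_const_mul _ hmeas,
    lintegral_indicator_one himg.isClosed.measurableSet]

lemma absDetSum_linearMap {n N : ℕ} (a : Fin N → Fin n → ℝ) (T : (Fin n → ℝ) →ₗ[ℝ] (Fin n → ℝ)) :
    absDetSum (fun j => T (a j)) = |LinearMap.det T| * absDetSum a := by
  unfold absDetSum
  rw [Finset.mul_sum]
  refine Finset.sum_congr rfl fun i _ => ?_
  rw [← abs_mul, ← LinearMap.det_toMatrix', ← Matrix.det_transpose (LinearMap.toMatrix' T), mul_comm,
    ← Matrix.det_mul]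
  congr 2
  ext k l
  have := congrFun (LinearMap.toMatrix'_mulVec T (a (i k))) l
  simp only [Matrix.of_apply, Function.comp_apply, Matrix.mul_apply, Matrix.transpose_apply]
  rw [← this, Matrix.mulVec, dotProduct]
  exact Finset.sum_congr rfl fun _ _ => mul_comm _ _

/-- **Volume of a zonotope**: `|∑ [-1,1] a_j| = 2^n ∑_{|I| = n} |det a_I|`, with the sum over
`n`-subsets written as a sum over `n`-tuples divided by `n!`. -/
theorem volume_zonotope : ∀ (N n : ℕ) (a : Fin N → Fin n → ℝ),
    volume (zonotope a) = ENNReal.ofReal (2 ^ n / n.factorial * absDetSum a)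
  | 0, 0, a => by
      have : zonotope a = Set.univ :=
        Set.eq_univ_of_forall fun x => ⟨0, by simp, Subsingleton.elim _ _⟩
      rw [this]
      simp [absDetSum, volume_pi]
  | 0, m + 1, a => by
      have : zonotope a = {0} := by
        ext x
        simp [zonotope]
      rw [this]
      simp [absDetSum]
  | N + 1, 0, a => by
      have : zonotope a = Set.univ :=
        Set.eq_univ_of_forall fun x => ⟨0, by simp, Subsingleton.elim _ _⟩
      rw [this]
      simp [absDetSum, volume_pi]
  | N + 1, m + 1, a => by
      by_cases hv : a 0 = 0
      · have h1 : zonotope a = zonotope (Fin.tail a) := by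
          rw [zonotope_succ, hv]
          ext x
          simp only [smul_zero, sub_zero, Set.mem_ofPred_eq]
          exact ⟨fun ⟨_, _, h⟩ => h, fun h => ⟨0, by simp, h⟩⟩
        have h2 : absDetSum a = absDetSum (Fin.tail a) := by
          rw [absDetSum_succ, Finset.sum_eq_zero, mul_zero, add_zero]
          intro i _
          rw [Matrix.det_eq_zero_of_row_eq_zero 0, abs_zero]
          simp [hv]
        rw [h1, h2]
        exact volume_zonotope N (m + 1) _
      -- a linear change of coordinates sends the first generator to `e₀`
      obtain ⟨T, hT⟩ := SeparatingDual.exists_continuousLinearEquiv_apply_eq (R := ℝ) hv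
        (show (Pi.single 0 1 : Fin (m + 1) → ℝ) ≠ 0 by simp)
      set L : (Fin (m + 1) → ℝ) →ₗ[ℝ] (Fin (m + 1) → ℝ) := T.toLinearEquiv.toLinearMap with hL
      have hLdet : |LinearMap.det L| ≠ 0 := abs_ne_zero.2 (LinearEquiv.isUnit_det' T.toLinearEquiv).ne_zero
      set b : Fin (N + 1) → Fin (m + 1) → ℝ := fun j => L (a j) with hb
      have hb0 : b 0 = Pi.single 0 1 := hT
      have hvol : volume (zonotope b) =
          ENNReal.ofReal (2 ^ (m + 1) / (m + 1).factorial * absDetSum b) := by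
        have htail : (Fin.tail '' zonotope (Fin.tail b) : Set (Fin m → ℝ)) =
            zonotope (fun j => Fin.tail (Fin.tail b j)) :=
          image_zonotope (Fin.tail b) (LinearMap.funLeft ℝ ℝ Fin.succ)
        have hsum : (∑ i : Fin m → Fin N, |Matrix.det (Matrix.of (Fin.cons (b 0) (Fin.tail b ∘ i) :
            Fin (m + 1) → Fin (m + 1) → ℝ))|) = absDetSum (fun j => Fin.tail (Fin.tail b j)) := by
          refine Finset.sum_congr rfl fun i _ => ?_
          rw [hb0, det_cons_single]
          rfl
        have := volume_add_segment (isCompact_zonotope (Fin.tail b)) (convex_zonotope (Fin.tail b))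
        rw [zonotope_succ, hb0, this, htail, volume_zonotope N (m + 1), volume_zonotope N m,
          show (2 : ENNReal) = ENNReal.ofReal 2 by simp, ← ENNReal.ofReal_mul (by norm_num),
          ← ENNReal.ofReal_add (mul_nonneg (by positivity) (absDetSum_nonneg _))
            (mul_nonneg (by norm_num) (mul_nonneg (by positivity) (absDetSum_nonneg _))),
          absDetSum_succ b, hsum]
        congr 1
        rw [Nat.factorial_succ]
        push_cast
        field_simp
        ring
      have h1 := Measure.addHaar_image_linearMap volume L (zonotope a)
      rw [image_zonotope, ← hb, hvol, hb, absDetSum_linearMap] at h1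
      rw [show 2 ^ (m + 1) / ((m + 1).factorial : ℝ) * (|LinearMap.det L| * absDetSum a) =
        |LinearMap.det L| * (2 ^ (m + 1) / ((m + 1).factorial : ℝ) * absDetSum a) by ring,
        ENNReal.ofReal_mul (abs_nonneg _)] at h1
      refine ((ENNReal.mul_right_inj ?_ ENNReal.ofReal_ne_top).1 h1).symm
      exact (ENNReal.ofReal_pos.2 (lt_of_le_of_ne (abs_nonneg _) hLdet.symm)).ne'

/-! ### The Cauchy-Binet formula -/

/-- **Cauchy–Binet**, with the sum over `n`-subsets written as a sum over `n`-tuples divided by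
`n!`. -/
theorem det_mul_transpose_eq_sum {n N : ℕ} (A : Matrix (Fin n) (Fin N) ℝ) :
    n.factorial * (A * A.transpose).det = ∑ i : Fin n → Fin N, (A.submatrix id i).det ^ 2 := by
  have expand : (A * A.transpose).det =
      ∑ i : Fin n → Fin N, (∏ k, A k (i k)) * (A.submatrix id i).det := by
    have : (A * A.transpose) = fun k => ∑ j, A k j • (A.transpose j) := by
      ext k l
      simp [Matrix.mul_apply]
    rw [this]
    change Matrix.detRowAlternating.toMultilinearMap _ = _
    rw [MultilinearMap.map_sum]
    refine Finset.sum_congr rfl fun i _ => ?_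
    rw [MultilinearMap.map_smul_univ, smul_eq_mul, ← Matrix.det_transpose (A.submatrix id i)]
    rfl
  have hσ : ∀ σ : Equiv.Perm (Fin n), (A * A.transpose).det =
      ∑ i : Fin n → Fin N, (Equiv.Perm.sign σ * ∏ k, A k (i (σ k))) * (A.submatrix id i).det := by
    intro σ
    rw [expand, ← (Equiv.arrowCongr σ.symm (Equiv.refl (Fin N))).sum_comp]
    refine Finset.sum_congr rfl fun i _ => ?_
    have h : A.submatrix id (Equiv.arrowCongr σ.symm (Equiv.refl (Fin N)) i) =
        (A.submatrix id i).submatrix id σ := by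
      ext; simp [Equiv.arrowCongr]
    rw [h, Matrix.det_permute']
    simp [Equiv.arrowCongr]
    ring
  calc (n.factorial : ℝ) * (A * A.transpose).det
      = ∑ σ : Equiv.Perm (Fin n), (A * A.transpose).det := by
        simp [Fintype.card_perm]
    _ = _ := by
        rw [Finset.sum_congr rfl fun σ _ => hσ σ, Finset.sum_comm]
        refine Finset.sum_congr rfl fun i _ => ?_
        rw [← Finset.sum_mul, sq]
        congr 1
        rw [← Matrix.det_transpose, Matrix.det_apply']
        rfl

/-! ### The three volumes -/

lemma imageVolume_eq_absDetSum {n N : ℕ} (A : Matrix (Fin n) (Fin N) ℝ) :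
    imageVolume A = 2 ^ n / n.factorial * absDetSum (fun j r => A r j) := by
  have h1 : Matrix.toEuclideanLin A '' cube N =
      (WithLp.ofLp ⁻¹' zonotope (fun j r => A r j) : Set (EuclideanSpace ℝ (Fin n))) := by
    have key : ∀ t : Fin N → ℝ, ∑ j, t j • (fun r => A r j) = A.mulVec t := by
      intro t
      ext r
      simp [Matrix.mulVec, dotProduct, mul_comm]
    ext x
    constructor
    · rintro ⟨t, ht, rfl⟩
      refine ⟨t.ofLp, ⟨fun i => (ht i).1, fun i => (ht i).2⟩, ?_⟩
      simp only [key, Matrix.ofLp_toLpLin, Matrix.toLin'_apply]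
    · rintro ⟨t, ⟨h1, h2⟩, hx⟩
      refine ⟨WithLp.toLp 2 t, fun i => ⟨h1 i, h2 i⟩, ?_⟩
      apply WithLp.ofLp_injective
      rw [Matrix.ofLp_toLpLin, Matrix.toLin'_apply, ← hx]
      simp only [key]
  unfold imageVolume
  rw [h1, (PiLp.volume_preserving_ofLp (Fin n)).measure_preimage
    (isCompact_zonotope _).isClosed.measurableSet.nullMeasurableSet, volume_zonotope,
    ENNReal.toReal_ofReal (mul_nonneg (by positivity) (absDetSum_nonneg _))]

lemma absDetSum_transpose {n N : ℕ} (A : Matrix (Fin n) (Fin N) ℝ) :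
    absDetSum (fun j r => A r j) = ∑ i : Fin n → Fin N, |(A.submatrix id i).det| := by
  refine Finset.sum_congr rfl fun i _ => ?_
  rw [← Matrix.det_transpose (A.submatrix id i)]
  rfl

lemma det_mul_transpose_nonneg {n N : ℕ} (A : Matrix (Fin n) (Fin N) ℝ) :
    0 ≤ (A * A.transpose).det := by
  have h := det_mul_transpose_eq_sum A
  have : 0 ≤ (n.factorial : ℝ) * (A * A.transpose).det := by
    rw [h]
    positivity
  exact nonneg_of_mul_nonneg_right this (by positivity)

lemma gramRoot_sq {n N : ℕ} (A : Matrix (Fin n) (Fin N) ℝ) :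
    gramRoot A ^ 2 = (A * A.transpose).det :=
  Real.sq_sqrt (det_mul_transpose_nonneg A)

lemma finrank_rowSpace {n N : ℕ} (A : Matrix (Fin n) (Fin N) ℝ) (h : (A * A.transpose).det ≠ 0) :
    Module.finrank ℝ (rowSpace A) = n := by
  have hinj : Function.Injective (Matrix.toEuclideanLin A.transpose) := by
    rw [← LinearMap.ker_eq_bot, LinearMap.ker_eq_bot']
    intro x hx
    have h2 : (A * A.transpose).mulVec x.ofLp = 0 := by
      have := congrArg WithLp.ofLp hx
      rw [Matrix.ofLp_toLpLin, Matrix.toLin'_apply] at this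
      rw [← Matrix.mulVec_mulVec, this]
      simp
    have := Matrix.eq_zero_of_mulVec_eq_zero h h2
    apply WithLp.ofLp_injective
    simpa using this
  unfold rowSpace
  rw [LinearMap.finrank_range_of_inj hinj]
  simp

/-- `|G B| = det (G G^*)^{1/2} |P_E B|`: the map `G` factors through the orthogonal projection
onto `E = Range G^*`, and its restriction to `E` has Jacobian `det (G G^*)^{1/2}`. -/
theorem imageVolume_eq_mul {n N : ℕ} (A : Matrix (Fin n) (Fin N) ℝ)
    (h : (A * A.transpose).det ≠ 0) :
    imageVolume A = gramRoot A * projectionVolume (rowSpace A) := by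
  set E := rowSpace A with hE
  have hfin : Module.finrank ℝ E = n := finrank_rowSpace A h
  let U : E ≃ₗᵢ[ℝ] EuclideanSpace ℝ (Fin n) :=
    ((stdOrthonormalBasis ℝ E).reindex (finCongr hfin)).repr
  let f : EuclideanSpace ℝ (Fin n) →ₗ[ℝ] EuclideanSpace ℝ (Fin n) :=
    Matrix.toEuclideanLin A ∘ₗ E.subtype ∘ₗ U.symm.toLinearEquiv.toLinearMap
  have hadj : ∀ (x : EuclideanSpace ℝ (Fin N)) (y : EuclideanSpace ℝ (Fin n)),
      inner ℝ (Matrix.toEuclideanLin A x) y = inner ℝ x (Matrix.toEuclideanLin A.transpose y) := by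
    intro x y
    rw [show A.transpose = A.conjTranspose by simp, Matrix.toEuclideanLin_conjTranspose_eq_adjoint,
      LinearMap.adjoint_inner_right]
  -- `A` does not see the component orthogonal to `E`
  have hproj : ∀ x : EuclideanSpace ℝ (Fin N),
      Matrix.toEuclideanLin A (E.orthogonalProjectionOnto x : EuclideanSpace ℝ (Fin N)) =
        Matrix.toEuclideanLin A x := by
    intro x
    apply ext_inner_right ℝ
    intro y
    rw [hadj, hadj]
    exact Submodule.inner_orthogonalProjectionOnto_eq_of_mem_right (K := E)
      ⟨Matrix.toEuclideanLin A.transpose y,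
      LinearMap.mem_range_self (Matrix.toEuclideanLin A.transpose) y⟩ x
  have himage : Matrix.toEuclideanLin A '' cube N =
      f '' (U '' (E.orthogonalProjectionOnto '' cube N)) := by
    simp only [Set.image_image]
    refine Set.image_congr fun x _ => ?_
    simp only [f, LinearMap.comp_apply, Submodule.subtype_apply]
    rw [← hproj x]
    congr 2
    exact (U.symm_apply_apply _).symm
  have hmem : ∀ y, Matrix.toEuclideanLin A.transpose y ∈ E :=
    fun y => LinearMap.mem_range_self (Matrix.toEuclideanLin A.transpose) y
  have hadjf : ∀ y, LinearMap.adjoint f y = U ⟨Matrix.toEuclideanLin A.transpose y, hmem y⟩ := by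
    intro y
    apply ext_inner_left ℝ
    intro x
    rw [LinearMap.adjoint_inner_right, ← U.symm.inner_map_map x, U.symm_apply_apply]
    exact hadj _ _
  have hcomp : f ∘ₗ LinearMap.adjoint f = Matrix.toEuclideanLin (A * A.transpose) := by
    ext1 y
    rw [LinearMap.comp_apply, hadjf]
    simp [f, Matrix.toLpLin_apply, Matrix.mulVec_mulVec]
  have hdet : ∀ M : Matrix (Fin n) (Fin n) ℝ, LinearMap.det (Matrix.toEuclideanLin M) = M.det := by
    intro M
    rw [Matrix.toEuclideanLin, Matrix.toLpLin_eq_toLin, LinearMap.det_toLin]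
  have hsq : |LinearMap.det f| = gramRoot A := by
    obtain ⟨M, hM⟩ := Matrix.toEuclideanLin.surjective f
    have h1 := congrArg LinearMap.det hcomp
    have h2 : LinearMap.adjoint f = Matrix.toEuclideanLin M.transpose := by
      rw [show M.transpose = M.conjTranspose by simp,
        Matrix.toEuclideanLin_conjTranspose_eq_adjoint, hM]
    rw [LinearMap.det_comp, h2, ← hM, hdet, hdet, hdet, Matrix.det_transpose] at h1
    rw [← hM, hdet, gramRoot, ← h1, Real.sqrt_mul_self_eq_abs]
  unfold imageVolume projectionVolume
  rw [himage, Measure.addHaar_image_linearMap, hsq, ENNReal.toReal_mul,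
    ENNReal.toReal_ofReal (show 0 ≤ gramRoot A from Real.sqrt_nonneg _)]
  congr 2
  rw [← U.measurePreserving.measure_preimage_equiv (f := U.toHomeomorph.toMeasurableEquiv)]
  congr 1
  exact Set.preimage_image_eq _ U.injective

/-- The cube lies in the ball of radius `√N`, and so do its projections. -/
theorem projectionVolume_le {n N : ℕ} (hn : 1 ≤ n) (E : Submodule ℝ (EuclideanSpace ℝ (Fin N)))
    (hE : Module.finrank ℝ E = n) :
    projectionVolume E ≤ √N ^ n * (√Real.pi ^ n / Real.Gamma (n / 2 + 1)) := by
  have : Nontrivial E := Module.nontrivial_of_finrank_pos (R := ℝ) (by omega)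
  have hsub : E.orthogonalProjectionOnto '' cube N ⊆ Metric.closedBall 0 √N := by
    rintro _ ⟨x, hx, rfl⟩
    rw [mem_closedBall_zero_iff]
    refine (E.norm_orthogonalProjectionOnto_apply_le x).trans ?_
    rw [EuclideanSpace.norm_eq]
    apply Real.sqrt_le_sqrt
    calc ∑ i, ‖x i‖ ^ 2 ≤ ∑ i : Fin N, (1 : ℝ) := by
          refine Finset.sum_le_sum fun i _ => ?_
          have := hx i
          rw [Set.mem_Icc, ← abs_le] at this
          rw [Real.norm_eq_abs, sq_abs, sq_le_one_iff_abs_le_one]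
          exact this
      _ = N := by simp
  have hG : 0 ≤ √Real.pi ^ n / Real.Gamma ((n : ℝ) / 2 + 1) :=
    div_nonneg (by positivity) (Real.Gamma_pos_of_pos (by positivity)).le
  unfold projectionVolume
  refine ENNReal.toReal_le_of_le_ofReal (mul_nonneg (by positivity) hG) ?_
  refine (measure_mono hsub).trans ?_
  rw [InnerProductSpace.volume_closedBall, hE, ENNReal.ofReal_mul (by positivity),
    ENNReal.ofReal_pow (by positivity)]

/-! ### Moments of sums of independent centred variables -/

/-- Binomial expansion with all terms of order at least two in `x` estimated crudely. -/
lemma add_pow_le_taylor (k : ℕ) (s x : ℝ) :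
    (s + x) ^ (2 * k + 2) ≤ s ^ (2 * k + 2) + (2 * k + 2) * (s ^ (2 * k + 1) * x) +
      4 ^ (k + 1) * ((1 + s ^ (2 * k)) * (1 + x ^ (2 * k + 2))) := by
  have aux : ∀ (y : ℝ) (i l : ℕ), i ≤ 2 * l → |y| ^ i ≤ 1 + y ^ (2 * l) := by
    intro y i l hil
    rcases le_total |y| 1 with h | h
    · have h1 : |y| ^ i ≤ 1 := pow_le_one₀ (abs_nonneg _) h
      have h2 : 0 ≤ y ^ (2 * l) := by rw [pow_mul]; positivity
      linarith
    · have h1 : |y| ^ i ≤ |y| ^ (2 * l) := pow_le_pow_right₀ h hil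
      rw [pow_mul, sq_abs, ← pow_mul] at h1
      linarith
  rw [add_pow, Finset.sum_range_succ, Finset.sum_range_succ]
  have h1 : (∑ j ∈ Finset.range (2 * k + 1), s ^ j * x ^ (2 * k + 2 - j) * ((2 * k + 2).choose j : ℝ)) ≤
      4 ^ (k + 1) * ((1 + s ^ (2 * k)) * (1 + x ^ (2 * k + 2))) := by
    have hpos : 0 ≤ (1 + s ^ (2 * k)) * (1 + x ^ (2 * k + 2)) := by
      have : 0 ≤ s ^ (2 * k) := by rw [pow_mul]; positivity
      have : 0 ≤ x ^ (2 * k + 2) := by rw [show 2 * k + 2 = 2 * (k + 1) by ring, pow_mul]; positivity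
      positivity
    calc _ ≤ ∑ j ∈ Finset.range (2 * k + 1),
          ((1 + s ^ (2 * k)) * (1 + x ^ (2 * k + 2))) * ((2 * k + 2).choose j : ℝ) := by
          refine Finset.sum_le_sum fun j hj => ?_
          refine mul_le_mul_of_nonneg_right ?_ (by positivity)
          rw [Finset.mem_range] at hj
          refine (le_abs_self _).trans ?_
          rw [abs_mul, abs_pow, abs_pow]
          have hs := aux s j k (by omega)
          have hx := aux x (2 * k + 2 - j) (k + 1) (by omega)
          rw [show 2 * (k + 1) = 2 * k + 2 by ring] at hx
          exact mul_le_mul hs hx (by positivity) ((by positivity : (0 : ℝ) ≤ |s| ^ j).trans hs)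
      _ ≤ ∑ j ∈ Finset.range (2 * k + 2 + 1),
          ((1 + s ^ (2 * k)) * (1 + x ^ (2 * k + 2))) * ((2 * k + 2).choose j : ℝ) := by
          refine Finset.sum_le_sum_of_subset_of_nonneg ?_ fun _ _ _ => by positivity
          exact Finset.range_subset_range.2 (by omega)
      _ = _ := by
          rw [← Finset.mul_sum]
          have := Nat.sum_range_choose (2 * k + 2)
          have h2 : (∑ j ∈ Finset.range (2 * k + 2 + 1), ((2 * k + 2).choose j : ℝ)) = 4 ^ (k + 1) := by
            rw [show (4 : ℝ) = 2 ^ 2 by norm_num, ← pow_mul, show 2 * (k + 1) = 2 * k + 2 by ring]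
            exact_mod_cast this
          rw [h2, mul_comm]
  have h2 : s ^ (2 * k + 1) * x ^ (2 * k + 2 - (2 * k + 1)) * ((2 * k + 2).choose (2 * k + 1) : ℝ) =
      (2 * k + 2) * (s ^ (2 * k + 1) * x) := by
    rw [show 2 * k + 2 - (2 * k + 1) = 1 by omega, show 2 * k + 2 = (2 * k + 1) + 1 by ring,
      Nat.choose_succ_self_right]
    push_cast
    ring
  have h3 : s ^ (2 * k + 2) * x ^ (2 * k + 2 - (2 * k + 2)) * ((2 * k + 2).choose (2 * k + 2) : ℝ) =
      s ^ (2 * k + 2) := by simp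
  linarith

lemma MeasureTheory.MemLp.integrable_pow_nat {Ω : Type*} [MeasurableSpace Ω] {μ : Measure Ω}
    [IsFiniteMeasure μ] {f : Ω → ℝ} (hf : ∀ q : ℕ, MemLp f q μ) (q : ℕ) :
    Integrable (fun ω => f ω ^ q) μ := by
  have h := (hf q).integrable_norm_pow'
  refine h.mono ((hf q).1.pow q) (ae_of_all _ fun ω => ?_)
  simp

/-- The moment of order `2k` of a sum of `m` independent centred variables is `O(m^k)`, with a
constant depending only on bounds `M` for the moments of the summands. -/
theorem exists_moment_sum_le (M : ℕ → ℝ) (k : ℕ) :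
    ∃ C : ℝ, 0 ≤ C ∧ ∀ {Ω : Type*} [MeasurableSpace Ω] (μ : Measure Ω) [IsProbabilityMeasure μ]
      (ξ : ℕ → Ω → ℝ), (∀ j (q : ℕ), MemLp (ξ j) q μ) → (∀ j q, ∫ ω, ξ j ω ^ (2 * q) ∂μ ≤ M q) →
      (∀ j, ∫ ω, ξ j ω ∂μ = 0) →
      (∀ m, IndepFun (fun ω => ∑ j ∈ Finset.range m, ξ j ω) (ξ m) μ) →
      ∀ m : ℕ, ∫ ω, (∑ j ∈ Finset.range m, ξ j ω) ^ (2 * k) ∂μ ≤ C * m ^ k := by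
  induction k with
  | zero =>
    refine ⟨1, zero_le_one, ?_⟩
    intro Ω _ μ _ ξ _ _ _ _ m
    simp
  | succ k ih =>
    obtain ⟨C, hC0, hC⟩ := ih
    refine ⟨4 ^ (k + 1) * ((1 + C) * (1 + |M (k + 1)|)), by positivity, ?_⟩
    intro Ω _ μ _ ξ hLp hM h0 hind m
    set D := 4 ^ (k + 1) * ((1 + C) * (1 + |M (k + 1)|)) with hD
    have hD0 : 0 ≤ D := by positivity
    induction m with
    | zero => simp
    | succ m ihm =>
      set S : Ω → ℝ := fun ω => ∑ j ∈ Finset.range m, ξ j ω with hS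
      have hSLp : ∀ q : ℕ, MemLp S q μ := fun q => memLp_finsetSum _ fun j _ => hLp j q
      have hSint := MemLp.integrable_pow_nat hSLp
      have hxint := MemLp.integrable_pow_nat (hLp m)
      have hmean : ∫ ω, S ω ^ (2 * k + 1) * ξ m ω ∂μ = 0 := by
        have := ((hind m).comp (φ := fun s : ℝ => s ^ (2 * k + 1)) (ψ := id) (by fun_prop)
          measurable_id).integral_fun_mul_eq_mul_integral (hSint (2 * k + 1)).1 (hLp m 1).1
        simp only [Function.comp_apply, id_eq] at this
        rw [this, h0 m, mul_zero]
      have hmeanint : Integrable (fun ω => S ω ^ (2 * k + 1) * ξ m ω) μ := by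
        have := ((hind m).comp (φ := fun s : ℝ => s ^ (2 * k + 1)) (ψ := fun x : ℝ => x ^ 1)
          (by fun_prop) (by fun_prop)).integrable_mul (hSint (2 * k + 1)) (hxint 1)
        simpa [Pi.mul_def, Function.comp_def] using this
      have hi1 : Integrable (fun ω => 1 + S ω ^ (2 * k)) μ := (integrable_const _).add (hSint _)
      have hi2 : Integrable (fun ω => 1 + ξ m ω ^ (2 * k + 2)) μ := (integrable_const _).add (hxint _)
      have hind2 := (hind m).comp (φ := fun s : ℝ => 1 + s ^ (2 * k))
          (ψ := fun x : ℝ => 1 + x ^ (2 * k + 2)) (by fun_prop) (by fun_prop)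
      have hprod : ∫ ω, (1 + S ω ^ (2 * k)) * (1 + ξ m ω ^ (2 * k + 2)) ∂μ =
          (1 + ∫ ω, S ω ^ (2 * k) ∂μ) * (1 + ∫ ω, ξ m ω ^ (2 * k + 2) ∂μ) := by
        have := hind2.integral_fun_mul_eq_mul_integral hi1.1 hi2.1
        simp only [Function.comp_apply] at this
        rw [this, integral_add (integrable_const _) (hSint _),
          integral_add (integrable_const _) (hxint _)]
        simp
      have hprodint : Integrable (fun ω => (1 + S ω ^ (2 * k)) * (1 + ξ m ω ^ (2 * k + 2))) μ :=
        hind2.integrable_mul hi1 hi2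
      have hstep : ∫ ω, (S ω + ξ m ω) ^ (2 * k + 2) ∂μ ≤ ∫ ω, S ω ^ (2 * k + 2) ∂μ +
          4 ^ (k + 1) * ((1 + ∫ ω, S ω ^ (2 * k) ∂μ) * (1 + ∫ ω, ξ m ω ^ (2 * k + 2) ∂μ)) := by
        have hint : Integrable (fun ω => (S ω + ξ m ω) ^ (2 * k + 2)) μ :=
          MemLp.integrable_pow_nat (fun q => (hSLp q).add (hLp m q)) _
        have h12 : Integrable (fun ω => S ω ^ (2 * k + 2) +
            (2 * k + 2 : ℝ) * (S ω ^ (2 * k + 1) * ξ m ω)) μ :=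
          (hSint (2 * k + 2)).add (hmeanint.const_mul (2 * k + 2 : ℝ))
        have := integral_mono hint (h12.add (hprodint.const_mul (4 ^ (k + 1) : ℝ)))
          (fun ω => add_pow_le_taylor k (S ω) (ξ m ω))
        simp only [Pi.add_apply] at this
        rw [integral_add h12 (hprodint.const_mul _),
          integral_add (hSint _) (hmeanint.const_mul _), integral_const_mul, integral_const_mul, hmean,
          hprod, mul_zero, add_zero] at this
        exact this
      have hSk := hC μ ξ hLp hM h0 hind m
      have hS0 : 0 ≤ ∫ ω, S ω ^ (2 * k) ∂μ :=
        integral_nonneg fun ω => by simp only [Pi.zero_apply]; rw [pow_mul]; positivity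
      have hx0 : ∫ ω, ξ m ω ^ (2 * k + 2) ∂μ ≤ |M (k + 1)| := (hM m (k + 1)).trans (le_abs_self _)
      have hx00 : 0 ≤ ∫ ω, ξ m ω ^ (2 * k + 2) ∂μ :=
        integral_nonneg fun ω => by
          simp only [Pi.zero_apply]; rw [show 2 * k + 2 = 2 * (k + 1) by ring, pow_mul]; positivity
      have hm1 : (1 : ℝ) ≤ ((m : ℝ) + 1) ^ k := one_le_pow₀ (by linarith [m.cast_nonneg (α := ℝ)])
      have hmk : (m : ℝ) ^ k ≤ ((m : ℝ) + 1) ^ k := pow_le_pow_left₀ (by positivity) (by linarith) k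
      have hA : 1 + ∫ ω, S ω ^ (2 * k) ∂μ ≤ (1 + C) * ((m : ℝ) + 1) ^ k := by
        have : C * (m : ℝ) ^ k ≤ C * ((m : ℝ) + 1) ^ k := mul_le_mul_of_nonneg_left hmk hC0
        linarith
      have hB : 4 ^ (k + 1) * ((1 + ∫ ω, S ω ^ (2 * k) ∂μ) * (1 + ∫ ω, ξ m ω ^ (2 * k + 2) ∂μ)) ≤
          D * ((m : ℝ) + 1) ^ k := by
        rw [hD, show 4 ^ (k + 1) * ((1 + C) * (1 + |M (k + 1)|)) * ((m : ℝ) + 1) ^ k =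
          4 ^ (k + 1) * (((1 + C) * ((m : ℝ) + 1) ^ k) * (1 + |M (k + 1)|)) by ring]
        refine mul_le_mul_of_nonneg_left ?_ (by positivity)
        exact mul_le_mul hA (by linarith) (by linarith) (by positivity)
      simp only [Finset.sum_range_succ]
      calc ∫ ω, (S ω + ξ m ω) ^ (2 * (k + 1)) ∂μ ≤ D * m ^ (k + 1) + D * ((m : ℝ) + 1) ^ k :=
            hstep.trans (add_le_add ihm hB)
        _ ≤ D * ((m : ℝ) + 1) ^ k * m + D * ((m : ℝ) + 1) ^ k := by
            have : D * (m : ℝ) ^ k * m ≤ D * ((m : ℝ) + 1) ^ k * m := by gcongr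
            rw [pow_succ, ← mul_assoc]
            linarith
        _ = D * ((m + 1 : ℕ) : ℝ) ^ (k + 1) := by push_cast; ring

/-! ### Averages over tuples of distinct indices -/

section TupleAverages

variable {E : Type*} [MeasurableSpace E] {ν : Measure E}
  {Ω : Type*} [MeasurableSpace Ω] {μ : Measure Ω} {g : ℕ → Ω → E}

lemma hasLaw_tuple [SigmaFinite ν] (hlaw : ∀ i, HasLaw (g i) ν μ) (hind : iIndepFun g μ) {n : ℕ}
    {i : Fin n → ℕ} (hi : Function.Injective i) :
    HasLaw (fun ω r => g (i r) ω) (Measure.pi fun _ : Fin n => ν) μ :=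
  iIndepFun.hasLaw_pi (fun r => hlaw (i r)) (hind.precomp hi)

lemma memLp_tuple [SigmaFinite ν] (hlaw : ∀ i, HasLaw (g i) ν μ) (hind : iIndepFun g μ) {n : ℕ}
    {i : Fin n → ℕ} (hi : Function.Injective i) {h : (Fin n → E) → ℝ} {q : ENNReal}
    (hq : MemLp h q (Measure.pi fun _ => ν)) : MemLp (fun ω => h fun r => g (i r) ω) q μ := by
  have hl := hasLaw_tuple hlaw hind hi
  rw [← hl.map_eq] at hq
  exact hq.comp_of_map hl.aemeasurable

lemma integral_tuple [SigmaFinite ν] (hlaw : ∀ i, HasLaw (g i) ν μ) (hind : iIndepFun g μ) {n : ℕ}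
    {i : Fin n → ℕ} (hi : Function.Injective i) {h : (Fin n → E) → ℝ} (hh : Measurable h) :
    ∫ ω, h (fun r => g (i r) ω) ∂μ = ∫ v, h v ∂(Measure.pi fun _ => ν) :=
  (hasLaw_tuple hlaw hind hi).integral_comp hh.aestronglyMeasurable

end TupleAverages

lemma injective_block (n j : ℕ) : Function.Injective (fun r : Fin n => j * n + (r : ℕ)) := by
  intro r s h
  exact Fin.ext (Nat.add_left_cancel h)

/-- Moments of a sum over disjoint blocks of `n` consecutive variables. -/
lemma exists_moment_block_le {E : Type*} [MeasurableSpace E] (ν : Measure E)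
    [IsProbabilityMeasure ν] {n : ℕ} {h : (Fin n → E) → ℝ} (hh : Measurable h)
    (hI : ∀ q : ℕ, MemLp h q (Measure.pi fun _ => ν)) (k : ℕ) :
    ∃ C : ℝ, 0 ≤ C ∧ ∀ {Ω : Type*} [MeasurableSpace Ω] (μ : Measure Ω) [IsProbabilityMeasure μ]
      (g : ℕ → Ω → E), (∀ i, HasLaw (g i) ν μ) → iIndepFun g μ → ∀ m : ℕ,
      ∫ ω, (∑ j ∈ Finset.range m, (h (fun r => g (j * n + r) ω) -
        ∫ v, h v ∂(Measure.pi fun _ => ν))) ^ (2 * k) ∂μ ≤ C * m ^ k := by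
  set θ := ∫ v, h v ∂(Measure.pi fun _ => ν) with hθ
  obtain ⟨C, hC0, hC⟩ := exists_moment_sum_le
    (fun q => ∫ v, (h v - θ) ^ (2 * q) ∂(Measure.pi fun _ => ν)) k
  refine ⟨C, hC0, ?_⟩
  intro Ω _ μ _ g hlaw hind m
  have hh' : Measurable fun v => h v - θ := hh.sub_const _
  have hI' : ∀ q : ℕ, MemLp (fun v => h v - θ) q (Measure.pi fun _ => ν) :=
    fun q => (hI q).sub (memLp_const θ)
  refine hC μ (fun j ω => h (fun r => g (j * n + r) ω) - θ)
    (fun j q => memLp_tuple hlaw hind (injective_block n j) (hI' q)) (fun j q => ?_)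
    (fun j => ?_) (fun m => ?_) m
  · exact (integral_tuple hlaw hind (injective_block n j) (hh'.pow_const _)).le
  · rw [integral_tuple hlaw hind (injective_block n j) hh',
      integral_sub ((hI 1).integrable (by simp)) (integrable_const _)]
    simp [hθ]
  · have hdisj : Disjoint (Finset.range (m * n)) (Finset.Ico (m * n) (m * n + n)) := by
      rw [Finset.disjoint_left]
      intro a ha hb
      rw [Finset.mem_range] at ha
      rw [Finset.mem_Ico] at hb
      omega
    have hmem1 : ∀ (j : Fin m) (r : Fin n), (j : ℕ) * n + r ∈ Finset.range (m * n) := by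
      intro j r
      rw [Finset.mem_range]
      calc (j : ℕ) * n + r < j * n + n := by omega
        _ = (j + 1) * n := by ring
        _ ≤ m * n := Nat.mul_le_mul_right _ j.2
    have hmem2 : ∀ r : Fin n, m * n + (r : ℕ) ∈ Finset.Ico (m * n) (m * n + n) := by
      intro r
      rw [Finset.mem_Ico]
      omega
    have key := (hind.indepFun_finset₀ _ _ hdisj fun i => (hlaw i).aemeasurable).comp
      (φ := fun x => ∑ j : Fin m, (h (fun r => x ⟨(j : ℕ) * n + r, hmem1 j r⟩) - θ))
      (ψ := fun x => h (fun r => x ⟨m * n + (r : ℕ), hmem2 r⟩) - θ)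
      (by fun_prop) (by fun_prop)
    convert key using 1
    · ext ω
      simp only [Function.comp_apply]
      rw [← Fin.sum_univ_eq_sum_range (fun j => h (fun r => g (j * n + r) ω) - θ)]
    · rfl

/-- Averaging over permutations spreads the value at a single injection uniformly over all
injections. -/
lemma card_mul_sum_perm {n N : ℕ} (F : (Fin n ↪ Fin N) → ℝ) (ι : Fin n ↪ Fin N) :
    Fintype.card (Fin n ↪ Fin N) * ∑ σ : Equiv.Perm (Fin N), F (ι.trans σ.toEmbedding) =
      N.factorial * ∑ e, F e := by
  have hindep : ∀ e : Fin n ↪ Fin N, ∑ σ : Equiv.Perm (Fin N), F (e.trans σ.toEmbedding) =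
      ∑ σ : Equiv.Perm (Fin N), F (ι.trans σ.toEmbedding) := by
    intro e
    obtain ⟨τ, hτ⟩ := (Equiv.Perm.isMultiplyPretransitive (Fin N) n).exists_smul_eq ι e
    refine Eq.trans (Finset.sum_congr rfl fun σ _ => congrArg F ?_)
      (Equiv.sum_comp (Equiv.mulRight τ) fun σ => F (ι.trans σ.toEmbedding))
    ext r
    have : e r = τ (ι r) := by rw [← hτ]; rfl
    simp [this]
  have hperm : ∀ σ : Equiv.Perm (Fin N), ∑ e : Fin n ↪ Fin N, F (e.trans σ.toEmbedding) =
      ∑ e, F e := fun σ => (Equiv.embeddingCongr (Equiv.refl _) σ).sum_comp F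
  calc (Fintype.card (Fin n ↪ Fin N) : ℝ) * ∑ σ : Equiv.Perm (Fin N), F (ι.trans σ.toEmbedding)
      = ∑ e : Fin n ↪ Fin N, ∑ σ : Equiv.Perm (Fin N), F (e.trans σ.toEmbedding) := by
        simp [hindep]
    _ = _ := by
        rw [Finset.sum_comm]
        simp [hperm, Fintype.card_perm]

/-- **Hoeffding's averaging argument.** The `2k`-th central moment of the average of `h` over all
`n`-tuples of distinct indices is `O(N^{-k})`: this average is an average over permutations of
averages over `⌊N/n⌋` independent blocks. -/
theorem exists_moment_injective_average_le {E : Type*} [MeasurableSpace E] (ν : Measure E)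
    [IsProbabilityMeasure ν] {n : ℕ} (hn : 1 ≤ n) {h : (Fin n → E) → ℝ} (hh : Measurable h)
    (hI : ∀ q : ℕ, MemLp h q (Measure.pi fun _ => ν)) (k : ℕ) :
    ∃ C : ℝ, 0 ≤ C ∧ ∀ {Ω : Type*} [MeasurableSpace Ω] (μ : Measure Ω) [IsProbabilityMeasure μ]
      (g : ℕ → Ω → E), (∀ i, HasLaw (g i) ν μ) → iIndepFun g μ → ∀ N : ℕ, n ≤ N →
      ∫ ω, ((∑ e : Fin n ↪ Fin N, (h (fun r => g (e r) ω) -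
        ∫ v, h v ∂(Measure.pi fun _ => ν))) / Fintype.card (Fin n ↪ Fin N)) ^ (2 * k) ∂μ
        ≤ C / N ^ k := by
  set θ := ∫ v, h v ∂(Measure.pi fun _ => ν) with hθ
  obtain ⟨C, hC0, hC⟩ := exists_moment_block_le ν hh hI k
  refine ⟨C * (2 * n) ^ k, by positivity, ?_⟩
  intro Ω _ μ _ g hlaw hind N hN
  set m := N / n with hm
  have hm1 : 1 ≤ m := (Nat.one_le_div_iff (by omega)).2 hN
  have hmN : m * n ≤ N := Nat.div_mul_le_self N n
  have hNm : (N : ℝ) ≤ 2 * n * m := by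
    have h1 : N < (m + 1) * n := by rw [mul_comm]; exact Nat.lt_mul_div_succ N (by omega)
    have h2 : (m + 1) * n ≤ 2 * n * m := by nlinarith
    exact_mod_cast h1.le.trans h2
  have hlt : ∀ (j : Fin m) (r : Fin n), (j : ℕ) * n + r < N := by
    intro j r
    calc (j : ℕ) * n + r < j * n + n := by omega
      _ = (j + 1) * n := by ring
      _ ≤ m * n := Nat.mul_le_mul_right _ j.2
      _ ≤ N := hmN
  let blk : Fin m → (Fin n ↪ Fin N) := fun j =>
    ⟨fun r => ⟨j * n + r, hlt j r⟩, fun r s hrs => injective_block n j (congrArg Fin.val hrs)⟩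
  -- a permutation of `{0, …, N - 1}` acting on all indices
  let ext : Equiv.Perm (Fin N) → ℕ → ℕ := fun σ i => if hi : i < N then σ ⟨i, hi⟩ else i
  have hext : ∀ σ, Function.Injective (ext σ) := by
    intro σ i j hij
    by_cases hi : i < N <;> by_cases hj : j < N
    · simp only [ext, hi, hj, dif_pos] at hij
      exact congrArg Fin.val (σ.injective (Fin.ext hij))
    · simp only [ext, hi, hj, dif_pos, dif_neg, not_false_eq_true] at hij
      omega
    · simp only [ext, hi, hj, dif_pos, dif_neg, not_false_eq_true] at hij
      omega
    · simpa only [ext, hi, hj, dif_neg, not_false_eq_true] using hij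
  let B : Equiv.Perm (Fin N) → Ω → ℝ := fun σ ω =>
    ∑ j ∈ Finset.range m, (h (fun r => g (ext σ (j * n + r)) ω) - θ)
  have hI' : ∀ q : ℕ, MemLp (fun v => h v - θ) q (Measure.pi fun _ => ν) :=
    fun q => (hI q).sub (memLp_const θ)
  have hBint : ∀ σ, Integrable (fun ω => B σ ω ^ (2 * k)) μ := fun σ =>
    MemLp.integrable_pow_nat (fun q => memLp_finsetSum _ fun j _ =>
      memLp_tuple hlaw hind ((hext σ).comp (injective_block n j)) (hI' q)) _
  have hB : ∀ σ, ∫ ω, B σ ω ^ (2 * k) ∂μ ≤ C * m ^ k := fun σ =>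
    hC μ (fun i => g (ext σ i)) (fun i => hlaw _) (hind.precomp (hext σ)) m
  have hcard : (0 : ℝ) < Fintype.card (Fin n ↪ Fin N) := by
    exact_mod_cast Fintype.card_pos_iff.2 ⟨blk ⟨0, hm1⟩⟩
  have hm0 : (0 : ℝ) < m := by exact_mod_cast hm1
  have hfac : (0 : ℝ) < N.factorial := by positivity
  have havg : ∀ ω, (∑ e : Fin n ↪ Fin N, (h (fun r => g (e r) ω) - θ)) /
      Fintype.card (Fin n ↪ Fin N) =
      ∑ σ : Equiv.Perm (Fin N), (1 / (N.factorial : ℝ)) * (B σ ω / m) := by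
    intro ω
    set F : (Fin n ↪ Fin N) → ℝ := fun e => h (fun r => g (e r) ω) - θ with hF
    have h1 : ∀ σ, B σ ω = ∑ j : Fin m, F ((blk j).trans σ.toEmbedding) := by
      intro σ
      simp only [B]
      rw [← Fin.sum_univ_eq_sum_range (fun j => h (fun r => g (ext σ (j * n + r)) ω) - θ)]
      refine Finset.sum_congr rfl fun j _ => ?_
      simp only [F, blk, ext, hlt, dif_pos]
      rfl
    have h2 : ∑ σ : Equiv.Perm (Fin N), B σ ω =
        m * (N.factorial * (∑ e, F e) / Fintype.card (Fin n ↪ Fin N)) := by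
      simp_rw [h1]
      rw [Finset.sum_comm, Finset.sum_congr rfl (fun j _ =>
        (eq_div_iff hcard.ne').2 ((mul_comm _ _).trans (card_mul_sum_perm F (blk j))))]
      simp
    rw [← Finset.mul_sum, ← Finset.sum_div, h2]
    field_simp
  have hjensen : ∀ ω, ((∑ e : Fin n ↪ Fin N, (h (fun r => g (e r) ω) - θ)) /
      Fintype.card (Fin n ↪ Fin N)) ^ (2 * k) ≤
      ∑ σ : Equiv.Perm (Fin N), (1 / (N.factorial : ℝ)) * (B σ ω / m) ^ (2 * k) := by
    intro ω
    rw [havg]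
    refine Real.pow_arith_mean_le_arith_mean_pow_of_even _ _ _ (fun _ _ => by positivity) ?_
      (even_two_mul k)
    simp [Fintype.card_perm, hfac.ne']
  have hint : ∀ σ, Integrable (fun ω => (1 / (N.factorial : ℝ)) * (B σ ω / m) ^ (2 * k)) μ := by
    intro σ
    simp_rw [div_pow]
    exact ((hBint σ).div_const _).const_mul _
  calc _ ≤ ∫ ω, ∑ σ : Equiv.Perm (Fin N), (1 / (N.factorial : ℝ)) * (B σ ω / m) ^ (2 * k) ∂μ := by
        refine integral_mono_of_nonneg (ae_of_all _ fun ω => ?_)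
          (integrable_finsetSum _ fun σ _ => hint σ) (ae_of_all _ hjensen)
        simp only [Pi.zero_apply]
        rw [pow_mul]
        positivity
    _ = ∑ σ : Equiv.Perm (Fin N), (1 / (N.factorial : ℝ)) *
          ((∫ ω, B σ ω ^ (2 * k) ∂μ) / m ^ (2 * k)) := by
        rw [integral_finsetSum _ fun σ _ => hint σ]
        refine Finset.sum_congr rfl fun σ _ => ?_
        simp_rw [div_pow]
        rw [integral_const_mul, integral_div]
    _ ≤ ∑ σ : Equiv.Perm (Fin N), (1 / (N.factorial : ℝ)) * ((C * m ^ k) / m ^ (2 * k)) := by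
        gcongr with σ _
        exact hB σ
    _ = C / m ^ k := by
        simp only [Finset.sum_const, Finset.card_univ, Fintype.card_perm, Fintype.card_fin,
          nsmul_eq_mul]
        rw [two_mul, pow_add]
        field_simp
    _ ≤ C * (2 * n) ^ k / N ^ k := by
        have hN0 : (0 : ℝ) < N := by exact_mod_cast (by omega : 0 < N)
        rw [div_le_div_iff₀ (by positivity) (by positivity), mul_assoc, ← mul_pow]
        exact mul_le_mul_of_nonneg_left (pow_le_pow_left₀ hN0.le hNm k) hC0

/-- The average of `h` over all `n`-tuples of indices below `N`. -/
noncomputable def tupleAverage {E Ω : Type*} {n : ℕ} (h : (Fin n → E) → ℝ) (g : ℕ → Ω → E) (N : ℕ)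
    (ω : Ω) : ℝ :=
  (∑ i : Fin n → Fin N, h fun r => g (i r) ω) / N ^ n

/-- Tuples with a repeated index do not contribute if `h` vanishes on them. -/
lemma sum_tuples_eq_sum_embedding {n N : ℕ} (F : (Fin n → Fin N) → ℝ)
    (hF : ∀ i, ¬ Function.Injective i → F i = 0) : ∑ i, F i = ∑ e : Fin n ↪ Fin N, F e :=
  (Fintype.sum_of_injective (fun e : Fin n ↪ Fin N => (e : Fin n → Fin N)) DFunLike.coe_injective
    (fun e => F e) F (fun i hi => hF i fun h => hi ⟨⟨i, h⟩, rfl⟩) fun _ => rfl).symm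

lemma memLp_tupleAverage {E : Type*} [MeasurableSpace E] {ν : Measure E} [SigmaFinite ν] {n : ℕ}
    {h : (Fin n → E) → ℝ} (hI : ∀ q : ℕ, MemLp h q (Measure.pi fun _ => ν))
    (h0 : ∀ v, ¬ Function.Injective v → h v = 0) {Ω : Type*} [MeasurableSpace Ω] {μ : Measure Ω}
    {g : ℕ → Ω → E} (hlaw : ∀ i, HasLaw (g i) ν μ) (hind : iIndepFun g μ) (N q : ℕ) :
    MemLp (tupleAverage h g N) q μ := by
  have hvan : ∀ ω, ∀ i : Fin n → Fin N, ¬ Function.Injective i → h (fun r => g (i r) ω) = 0 := by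
    intro ω i hi
    refine h0 _ fun hinj => hi fun r s hrs => hinj ?_
    simp [hrs]
  have heq : tupleAverage h g N =
      fun ω => (∑ e : Fin n ↪ Fin N, h fun r => g (e r) ω) * ((N : ℝ) ^ n)⁻¹ := by
    ext ω
    rw [← div_eq_mul_inv, tupleAverage]
    exact congrArg (· / (N : ℝ) ^ n)
      (sum_tuples_eq_sum_embedding (fun i : Fin n → Fin N => h fun r => g (i r) ω) (hvan ω))
  have hs : MemLp (fun ω => ∑ e : Fin n ↪ Fin N, h fun r => g (e r) ω) q μ :=
    memLp_finsetSum (f := fun (e : Fin n ↪ Fin N) ω => h fun r => g (e r) ω) Finset.univ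
      fun e _ => memLp_tuple hlaw hind (Fin.val_injective.comp e.injective) (hI q)
  rw [heq]
  exact hs.mul_const _

/-- The proportion of tuples with distinct entries is `1 + O(1/N)`. -/
lemma one_sub_card_embedding_div_le {n N : ℕ} (hn : 1 ≤ n) (hN : n ≤ N) :
    1 - (Fintype.card (Fin n ↪ Fin N) : ℝ) / N ^ n ≤ n ^ 2 / N := by
  have hN0 : (0 : ℝ) < N := by exact_mod_cast (by omega : 0 < N)
  have h1 : ((N + 1 - n : ℕ) : ℝ) ^ n ≤ Fintype.card (Fin n ↪ Fin N) := by
    rw [Fintype.card_embedding_eq, Fintype.card_fin, Fintype.card_fin]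
    exact_mod_cast Nat.pow_sub_le_descFactorial N n
  have h2 : (1 : ℝ) + n * (-(n / N)) ≤ (1 + -(n / N)) ^ n := by
    apply one_add_mul_le_pow
    have : (n : ℝ) / N ≤ 1 := (div_le_one hN0).2 (by exact_mod_cast hN)
    linarith
  have h3 : (1 + -((n : ℝ) / N)) ^ n ≤ (Fintype.card (Fin n ↪ Fin N) : ℝ) / N ^ n := by
    rw [le_div_iff₀ (by positivity), ← mul_pow]
    refine le_trans (pow_le_pow_left₀ ?_ ?_ n) h1
    · have : (n : ℝ) / N ≤ 1 := (div_le_one hN0).2 (by exact_mod_cast hN)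
      exact mul_nonneg (by linarith) hN0.le
    · rw [Nat.cast_sub (by omega)]
      push_cast
      field_simp
      linarith
  have h4 : (n : ℝ) * (-(n / N)) = -(n ^ 2 / N) := by ring
  linarith

lemma card_embedding_div_le_one (n N : ℕ) : (Fintype.card (Fin n ↪ Fin N) : ℝ) / N ^ n ≤ 1 := by
  refine div_le_one_of_le₀ ?_ (by positivity)
  rw [Fintype.card_embedding_eq, Fintype.card_fin, Fintype.card_fin]
  exact_mod_cast Nat.descFactorial_le_pow N n

lemma add_pow_two_mul_le (k : ℕ) (x y : ℝ) :
    (x + y) ^ (2 * k) ≤ 4 ^ k * (x ^ (2 * k) + y ^ (2 * k)) := by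
  rw [pow_mul, pow_mul, pow_mul]
  have h1 : (x + y) ^ 2 ≤ 2 * (x ^ 2 + y ^ 2) := by nlinarith [sq_nonneg (x - y)]
  calc ((x + y) ^ 2) ^ k ≤ (2 * (x ^ 2 + y ^ 2)) ^ k := pow_le_pow_left₀ (sq_nonneg _) h1 k
    _ = 2 ^ k * (x ^ 2 + y ^ 2) ^ k := mul_pow _ _ _
    _ ≤ 2 ^ k * (2 ^ k * ((x ^ 2) ^ k + (y ^ 2) ^ k)) := by
        gcongr
        refine (add_pow_le (sq_nonneg x) (sq_nonneg y) k).trans ?_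
        gcongr
        · norm_num
        · omega
    _ = 4 ^ k * ((x ^ 2) ^ k + (y ^ 2) ^ k) := by
        rw [← mul_assoc, ← mul_pow]
        norm_num

/-- Moments of a tuple average around the limiting mean: `V_N = θ + O(N^{-1/2})` in every `L^{2k}`. -/
theorem exists_moment_tupleAverage_le {E : Type*} [MeasurableSpace E] (ν : Measure E)
    [IsProbabilityMeasure ν] {n : ℕ} (hn : 1 ≤ n) {h : (Fin n → E) → ℝ} (hh : Measurable h)
    (hI : ∀ q : ℕ, MemLp h q (Measure.pi fun _ => ν))
    (h0 : ∀ v, ¬ Function.Injective v → h v = 0) (k : ℕ) :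
    ∃ C : ℝ, 0 ≤ C ∧ ∀ {Ω : Type*} [MeasurableSpace Ω] (μ : Measure Ω) [IsProbabilityMeasure μ]
      (g : ℕ → Ω → E), (∀ i, HasLaw (g i) ν μ) → iIndepFun g μ → ∀ N : ℕ, n ≤ N →
      ∫ ω, (tupleAverage h g N ω - ∫ v, h v ∂(Measure.pi fun _ => ν)) ^ (2 * k) ∂μ ≤ C / N ^ k := by
  set θ := ∫ v, h v ∂(Measure.pi fun _ => ν) with hθ
  obtain ⟨C, hC0, hC⟩ := exists_moment_injective_average_le ν hn hh hI k
  refine ⟨4 ^ k * (C + (n ^ 2 * θ) ^ (2 * k)), ?_, ?_⟩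
  · have : 0 ≤ ((n : ℝ) ^ 2 * θ) ^ (2 * k) := by rw [pow_mul]; positivity
    positivity
  intro Ω _ μ _ g hlaw hind N hN
  have hN1 : (1 : ℝ) ≤ N := by exact_mod_cast hn.trans hN
  have hN0 : (0 : ℝ) < N := by linarith
  set c : ℝ := (Fintype.card (Fin n ↪ Fin N) : ℝ) with hc
  have hc0 : 0 < c := by
    have : 0 < Fintype.card (Fin n ↪ Fin N) := Fintype.card_pos_iff.2 ⟨Fin.castLEEmb hN⟩
    rw [hc]
    exact Nat.cast_pos.2 this
  set U : Ω → ℝ := fun ω => (∑ e : Fin n ↪ Fin N, (h (fun r => g (e r) ω) - θ)) / c with hU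
  have hdecomp : ∀ ω, tupleAverage h g N ω - θ = c / N ^ n * U ω + -(1 - c / N ^ n) * θ := by
    intro ω
    have hvan : ∀ i : Fin n → Fin N, ¬ Function.Injective i → h (fun r => g (i r) ω) = 0 := by
      intro i hi
      refine h0 _ fun hinj => hi fun r s hrs => hinj ?_
      simp [hrs]
    have := sum_tuples_eq_sum_embedding (N := N) (fun i => h fun r => g (i r) ω) hvan
    simp only [tupleAverage, hU]
    rw [this, Finset.sum_sub_distrib, Finset.sum_const, Finset.card_univ, nsmul_eq_mul, ← hc]
    field_simp
    ring
  have hUnn : ∀ ω, 0 ≤ U ω ^ (2 * k) := fun ω => by rw [pow_mul]; positivity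
  have hUint : Integrable (fun ω => U ω ^ (2 * k)) μ := by
    refine MemLp.integrable_pow_nat (fun q => ?_) _
    have hs : MemLp (fun ω => ∑ e : Fin n ↪ Fin N, (h (fun r => g (e r) ω) - θ)) q μ :=
      memLp_finsetSum (f := fun (e : Fin n ↪ Fin N) ω => h (fun r => g (e r) ω) - θ) Finset.univ
        fun e _ => (memLp_tuple hlaw hind (Fin.val_injective.comp e.injective) (hI q)).sub
          (memLp_const θ)
    simp_rw [hU, div_eq_mul_inv]
    exact hs.mul_const _
  have hcle : c / N ^ n ≤ 1 := card_embedding_div_le_one n N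
  have hcpos : 0 ≤ c / N ^ n := by positivity
  have hdet : (-(1 - c / N ^ n) * θ) ^ (2 * k) ≤ (n ^ 2 * θ) ^ (2 * k) / N ^ k := by
    have h1 : (1 - c / N ^ n) ^ (2 * k) ≤ ((n : ℝ) ^ 2 / N) ^ (2 * k) :=
      pow_le_pow_left₀ (by linarith) (one_sub_card_embedding_div_le hn hN) _
    have h2 : 0 ≤ θ ^ (2 * k) := by rw [pow_mul]; positivity
    rw [mul_pow, (even_two_mul k).neg_pow]
    calc (1 - c / N ^ n) ^ (2 * k) * θ ^ (2 * k)
        ≤ ((n : ℝ) ^ 2 / N) ^ (2 * k) * θ ^ (2 * k) := mul_le_mul_of_nonneg_right h1 h2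
      _ = (n ^ 2 * θ) ^ (2 * k) / N ^ (2 * k) := by rw [div_pow, mul_pow]; ring
      _ ≤ (n ^ 2 * θ) ^ (2 * k) / N ^ k := by
          have : 0 ≤ ((n : ℝ) ^ 2 * θ) ^ (2 * k) := by rw [pow_mul]; positivity
          gcongr
          omega
  calc ∫ ω, (tupleAverage h g N ω - θ) ^ (2 * k) ∂μ
      ≤ ∫ ω, (4 ^ k * (U ω ^ (2 * k) + (n ^ 2 * θ) ^ (2 * k) / N ^ k)) ∂μ := by
        refine integral_mono_of_nonneg (ae_of_all _ fun ω => ?_)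
          ((hUint.add (integrable_const _)).const_mul _) (ae_of_all _ fun ω => ?_)
        · simp only [Pi.zero_apply]
          rw [pow_mul]
          positivity
        · simp only [hdecomp]
          refine (add_pow_two_mul_le k _ _).trans ?_
          have : (c / N ^ n * U ω) ^ (2 * k) ≤ U ω ^ (2 * k) := by
            rw [mul_pow]
            exact mul_le_of_le_one_left (hUnn ω) (pow_le_one₀ hcpos hcle)
          gcongr
    _ = 4 ^ k * ((∫ ω, U ω ^ (2 * k) ∂μ) + (n ^ 2 * θ) ^ (2 * k) / N ^ k) := by
        rw [integral_const_mul, integral_add hUint (integrable_const _)]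
        simp
    _ ≤ 4 ^ k * (C / N ^ k + (n ^ 2 * θ) ^ (2 * k) / N ^ k) := by
        gcongr
        exact hC μ g hlaw hind N hN
    _ = _ := by ring

/-! ### Gaussian determinants -/

/-- The determinant of the matrix with the given columns. -/
noncomputable def colDet {n : ℕ} (v : Fin n → EuclideanSpace ℝ (Fin n)) : ℝ :=
  (Matrix.of fun i j => v j i : Matrix (Fin n) (Fin n) ℝ).det

lemma continuous_colDet (n : ℕ) : Continuous (colDet (n := n)) := by
  unfold colDet
  refine Continuous.matrix_det (continuous_matrix fun i j => ?_)
  simp only [Matrix.of_apply]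
  fun_prop

lemma colDet_eq_zero_of_not_injective {n : ℕ} {v : Fin n → EuclideanSpace ℝ (Fin n)}
    (hv : ¬ Function.Injective v) : colDet v = 0 := by
  simp only [Function.Injective, not_forall] at hv
  obtain ⟨r, s, hrs, hne⟩ := hv
  exact Matrix.det_zero_of_column_eq hne (by simp [hrs])

lemma abs_colDet_le {n : ℕ} (v : Fin n → EuclideanSpace ℝ (Fin n)) :
    |colDet v| ≤ n.factorial * ∏ j, ‖v j‖ := by
  unfold colDet
  rw [Matrix.det_apply']
  refine (Finset.abs_sum_le_sum_abs _ _).trans ?_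
  calc _ ≤ ∑ σ : Equiv.Perm (Fin n), ∏ j, ‖v j‖ := by
        refine Finset.sum_le_sum fun σ _ => ?_
        have : |((Equiv.Perm.sign σ : ℤ) : ℝ)| = 1 := by
          rcases Int.units_eq_one_or (Equiv.Perm.sign σ) with h | h <;> simp [h]
        rw [abs_mul, this, one_mul, Finset.abs_prod]
        exact Finset.prod_le_prod (fun _ _ => abs_nonneg _) fun j _ => PiLp.norm_apply_le (v j) (σ j)
    _ = _ := by simp [Fintype.card_perm]

lemma memLp_colDet (n q : ℕ) : MemLp (colDet (n := n)) q
    (Measure.pi fun _ => stdGaussian (EuclideanSpace ℝ (Fin n))) := by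
  have hmeas : AEStronglyMeasurable (colDet (n := n))
      (Measure.pi fun _ => stdGaussian (EuclideanSpace ℝ (Fin n))) :=
    (continuous_colDet n).aestronglyMeasurable
  rcases Nat.eq_zero_or_pos q with rfl | hq
  · simpa using hmeas
  rw [← integrable_norm_rpow_iff hmeas (by simpa using hq.ne') (by simp)]
  simp only [ENNReal.toReal_natCast, Real.rpow_natCast]
  have hprod : Integrable (fun v : Fin n → EuclideanSpace ℝ (Fin n) => ∏ j, ‖v j‖ ^ q)
      (Measure.pi fun _ => stdGaussian (EuclideanSpace ℝ (Fin n))) := by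
    refine Integrable.fintype_prod (f := fun _ (x : EuclideanSpace ℝ (Fin n)) => ‖x‖ ^ q) fun j => ?_
    exact (IsGaussian.memLp_id (stdGaussian (EuclideanSpace ℝ (Fin n))) q (by simp)).integrable_norm_pow'
  refine (hprod.const_mul ((n.factorial : ℝ) ^ q)).mono' (hmeas.norm.pow q) (ae_of_all _ fun v => ?_)
  rw [Real.norm_eq_abs, abs_pow, Real.norm_eq_abs, abs_abs, Finset.prod_pow, ← mul_pow]
  exact pow_le_pow_left₀ (abs_nonneg _) (abs_colDet_le v) q

lemma memLp_colDet_sq (n q : ℕ) : MemLp (fun v => colDet (n := n) v ^ 2) q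
    (Measure.pi fun _ => stdGaussian (EuclideanSpace ℝ (Fin n))) := by
  have hmeas : AEStronglyMeasurable (fun v => colDet (n := n) v ^ 2)
      (Measure.pi fun _ => stdGaussian (EuclideanSpace ℝ (Fin n))) :=
    ((continuous_colDet n).pow 2).aestronglyMeasurable
  rcases Nat.eq_zero_or_pos q with rfl | hq
  · simpa using hmeas
  rw [← integrable_norm_rpow_iff hmeas (by simpa using hq.ne') (by simp)]
  simp only [ENNReal.toReal_natCast, Real.rpow_natCast]
  have := (memLp_colDet n (2 * q)).integrable_norm_pow'
  simpa [pow_mul] using this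

lemma integral_mul_stdGaussian {n : ℕ} (a b : Fin n) :
    ∫ x, x a * x b ∂(stdGaussian (EuclideanSpace ℝ (Fin n))) = if a = b then 1 else 0 := by
  have h := covarianceBilin_apply (μ := stdGaussian (EuclideanSpace ℝ (Fin n)))
    (IsGaussian.memLp_two_id) (EuclideanSpace.single a (1 : ℝ)) (EuclideanSpace.single b (1 : ℝ))
  rw [covarianceBilin_stdGaussian] at h
  simp only [innerSL_apply_apply ℝ, integral_id_stdGaussian, id_eq, sub_zero,
    EuclideanSpace.inner_single_left, map_one, one_mul] at h
  rw [← h]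
  simp

/-- `𝔼 det [g_1 ⋯ g_n]^2 = n!`. -/
lemma integral_colDet_sq (n : ℕ) :
    ∫ v, colDet v ^ 2 ∂(Measure.pi fun _ : Fin n => stdGaussian (EuclideanSpace ℝ (Fin n))) =
      n.factorial := by
  have hexp : ∀ v : Fin n → EuclideanSpace ℝ (Fin n), colDet v ^ 2 =
      ∑ σ : Equiv.Perm (Fin n), ∑ τ : Equiv.Perm (Fin n),
        ((Equiv.Perm.sign σ : ℤ) : ℝ) * ((Equiv.Perm.sign τ : ℤ) : ℝ) *
          ∏ j, (v j (σ j) * v j (τ j)) := by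
    intro v
    unfold colDet
    rw [sq, Matrix.det_apply', Finset.sum_mul_sum]
    refine Finset.sum_congr rfl fun σ _ => Finset.sum_congr rfl fun τ _ => ?_
    rw [Finset.prod_mul_distrib]
    simp only [Matrix.of_apply]
    ring
  have hint : ∀ σ τ : Equiv.Perm (Fin n), Integrable
      (fun v : Fin n → EuclideanSpace ℝ (Fin n) => ∏ j, (v j (σ j) * v j (τ j)))
      (Measure.pi fun _ => stdGaussian (EuclideanSpace ℝ (Fin n))) := by
    intro σ τ
    refine Integrable.fintype_prod (f := fun j (x : EuclideanSpace ℝ (Fin n)) => x (σ j) * x (τ j))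
      fun j => ?_
    have h2 : ∀ a : Fin n, MemLp (fun x : EuclideanSpace ℝ (Fin n) => x a) 2
        (stdGaussian (EuclideanSpace ℝ (Fin n))) := fun a =>
      IsGaussian.memLp_dual _ (EuclideanSpace.proj a) 2 (by simp)
    exact (h2 _).integrable_mul (h2 _)
  have hval : ∀ σ τ : Equiv.Perm (Fin n),
      ∫ v : Fin n → EuclideanSpace ℝ (Fin n), ∏ j, (v j (σ j) * v j (τ j))
        ∂(Measure.pi fun _ => stdGaussian (EuclideanSpace ℝ (Fin n))) = if σ = τ then 1 else 0 := by
    intro σ τ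
    rw [integral_fintype_prod_eq_prod
      (f := fun j (x : EuclideanSpace ℝ (Fin n)) => x (σ j) * x (τ j))]
    simp_rw [integral_mul_stdGaussian]
    split_ifs with h
    · simp [h]
    · obtain ⟨j, hj⟩ := not_forall.1 fun h' => h (Equiv.ext h')
      exact Finset.prod_eq_zero (Finset.mem_univ j) (if_neg hj)
  simp_rw [hexp]
  rw [integral_finsetSum _ fun σ _ => integrable_finsetSum _ fun τ _ => (hint σ τ).const_mul _]
  simp_rw [integral_finsetSum _ fun τ _ => (hint _ τ).const_mul _, integral_const_mul, hval]
  simp only [mul_ite, mul_one, mul_zero, Finset.sum_ite_eq, Finset.mem_univ, if_true]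
  have : ∀ σ : Equiv.Perm (Fin n), ((Equiv.Perm.sign σ : ℤ) : ℝ) * ((Equiv.Perm.sign σ : ℤ) : ℝ) = 1 := by
    intro σ
    rcases Int.units_eq_one_or (Equiv.Perm.sign σ) with h | h <;> simp [h]
  simp [this, Fintype.card_perm]

/-- A proper subspace is null for the standard Gaussian measure. -/
lemma stdGaussian_submodule_eq_zero {n : ℕ} (W : Submodule ℝ (EuclideanSpace ℝ (Fin n)))
    (hW : W ≠ ⊤) : stdGaussian (EuclideanSpace ℝ (Fin n)) (W : Set (EuclideanSpace ℝ (Fin n))) = 0 := by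
  obtain ⟨w, hw, hw0⟩ := Submodule.exists_mem_ne_zero_of_ne_bot
    (fun h => hW (Submodule.orthogonal_eq_bot_iff.1 h) : Wᗮ ≠ ⊥)
  let L : StrongDual ℝ (EuclideanSpace ℝ (Fin n)) := innerSL ℝ w
  have hL : ‖L‖ = ‖w‖ := innerSL_apply_norm ℝ w
  have hvar : (Var[L; stdGaussian (EuclideanSpace ℝ (Fin n))]).toNNReal ≠ 0 := by
    rw [variance_dual_stdGaussian, hL]
    simpa using hw0
  have := nullSingletonClass_gaussianReal
    (μ := ∫ x, L x ∂(stdGaussian (EuclideanSpace ℝ (Fin n)))) hvar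
  have hsub : (W : Set (EuclideanSpace ℝ (Fin n))) ⊆ L ⁻¹' {0} := by
    intro x hx
    exact (Submodule.mem_orthogonal' W w).1 hw x hx
  refine measure_mono_null hsub ?_
  rw [← Measure.map_apply L.continuous.measurable (measurableSet_singleton 0),
    IsGaussian.map_eq_gaussianReal L]
  exact measure_singleton 0

/-- At most `n` independent Gaussian vectors in `ℝ^n` are almost surely linearly independent. -/
lemma ae_linearIndependent {n : ℕ} : ∀ k ≤ n,
    ∀ᵐ v ∂(Measure.pi fun _ : Fin k => stdGaussian (EuclideanSpace ℝ (Fin n))),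
      LinearIndependent ℝ v
  | 0, _ => ae_of_all _ fun _ => linearIndependent_empty_type
  | k + 1, hk => by
      have ih := ae_linearIndependent k (by omega : k ≤ n)
      have hmp := (measurePreserving_piFinSuccAbove
        (fun _ : Fin (k + 1) => stdGaussian (EuclideanSpace ℝ (Fin n))) 0)
      have hmeas : MeasurableSet {z : EuclideanSpace ℝ (Fin n) × (Fin k → EuclideanSpace ℝ (Fin n)) |
          LinearIndependent ℝ (Fin.cons z.1 z.2 : Fin (k + 1) → EuclideanSpace ℝ (Fin n))} := by
        have hc : Continuous fun z : EuclideanSpace ℝ (Fin n) × (Fin k → EuclideanSpace ℝ (Fin n)) =>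
            (Fin.cons z.1 z.2 : Fin (k + 1) → EuclideanSpace ℝ (Fin n)) := by
          refine continuous_pi fun i => ?_
          refine Fin.cases ?_ (fun j => ?_) i <;> simp only [Fin.cons_zero, Fin.cons_succ] <;> fun_prop
        exact (isOpen_setOfPred_linearIndependent.preimage hc).measurableSet
      have hprod : ∀ᵐ z ∂((stdGaussian (EuclideanSpace ℝ (Fin n))).prod
          (Measure.pi fun _ : Fin k => stdGaussian (EuclideanSpace ℝ (Fin n)))),
          LinearIndependent ℝ (Fin.cons z.1 z.2 : Fin (k + 1) → EuclideanSpace ℝ (Fin n)) := by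
        rw [Measure.ae_prod_iff_ae_ae hmeas, Measure.ae_ae_comm hmeas]
        filter_upwards [ih] with v hv
        have hspan : Submodule.span ℝ (Set.range v) ≠ ⊤ := by
          intro h
          have h1 := finrank_span_eq_card hv
          rw [h, finrank_top] at h1
          simp at h1
          omega
        have h0 := stdGaussian_submodule_eq_zero _ hspan
        filter_upwards [measure_eq_zero_iff_ae_notMem.1 h0] with x hx
        exact linearIndependent_finCons.2 ⟨hv, hx⟩
      filter_upwards [hmp.quasiMeasurePreserving.ae hprod] with v hv
      convert hv using 1
      ext1 i
      refine Fin.cases ?_ (fun j => ?_) i <;> simp [MeasurableEquiv.piFinSuccAbove, Fin.tail]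

lemma ae_colDet_ne_zero (n : ℕ) :
    ∀ᵐ v ∂(Measure.pi fun _ : Fin n => stdGaussian (EuclideanSpace ℝ (Fin n))), colDet v ≠ 0 := by
  filter_upwards [ae_linearIndependent (n := n) n le_rfl] with v hv
  have h1 : LinearIndependent ℝ (Matrix.of fun i j => v j i : Matrix (Fin n) (Fin n) ℝ).col :=
    hv.map' (WithLp.linearEquiv 2 ℝ (Fin n → ℝ)).toLinearMap (LinearEquiv.ker _)
  rw [Matrix.linearIndependent_cols_iff_isUnit, Matrix.isUnit_iff_isUnit_det] at h1
  exact h1.ne_zero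

/-! ### `X_N` and `Y_N^2` as tuple averages -/

section Volumes

variable {n : ℕ} {Ω : Type*} (g : ℕ → Ω → EuclideanSpace ℝ (Fin n))

lemma det_submatrix_colMatrix {N : ℕ} (v : ℕ → EuclideanSpace ℝ (Fin n)) (i : Fin n → Fin N) :
    ((colMatrix N v).submatrix id i).det = colDet fun r => v (i r) := rfl

lemma XN_eq_tupleAverage {N : ℕ} (hN : 1 ≤ N) (ω : Ω) :
    XN g N ω = N ^ n * (2 ^ n / n.factorial * tupleAverage (fun v => |colDet v|) g N ω) := by
  have hN0 : (N : ℝ) ≠ 0 := by exact_mod_cast (by omega : N ≠ 0)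
  unfold XN tupleAverage
  rw [imageVolume_eq_absDetSum, absDetSum_transpose]
  simp_rw [det_submatrix_colMatrix]
  field_simp

lemma YN_sq_eq_tupleAverage {N : ℕ} (hN : 1 ≤ N) (ω : Ω) :
    YN g N ω ^ 2 = N ^ n * (1 / n.factorial * tupleAverage (fun v => colDet v ^ 2) g N ω) := by
  have hN0 : (N : ℝ) ≠ 0 := by exact_mod_cast (by omega : N ≠ 0)
  have h := det_mul_transpose_eq_sum (colMatrix N fun i => g i ω)
  simp_rw [det_submatrix_colMatrix] at h
  unfold YN tupleAverage
  rw [gramRoot_sq, ← h]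
  field_simp

variable {g} [MeasurableSpace Ω] {μ : Measure Ω}

/-- The Gaussian matrix has full rank almost surely. -/
lemma ae_det_gram_ne_zero (hlaw : ∀ i, HasLaw (g i) (stdGaussian (EuclideanSpace ℝ (Fin n))) μ)
    (hind : iIndepFun g μ) {N : ℕ} (hN : n ≤ N) :
    ∀ᵐ ω ∂μ, ((colMatrix N fun i => g i ω) * (colMatrix N fun i => g i ω).transpose).det ≠ 0 := by
  have hl := hasLaw_tuple hlaw hind (Fin.val_injective (n := n))
  have h1 := ae_colDet_ne_zero n
  rw [← hl.map_eq] at h1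
  filter_upwards [ae_of_ae_map hl.aemeasurable h1] with ω hω h0
  have h2 := det_mul_transpose_eq_sum (colMatrix N fun i => g i ω)
  rw [h0, mul_zero] at h2
  have h3 := (Finset.sum_eq_zero_iff_of_nonneg fun _ _ => sq_nonneg _).1 h2.symm (Fin.castLE hN)
    (Finset.mem_univ _)
  rw [det_submatrix_colMatrix] at h3
  exact hω (pow_eq_zero_iff two_ne_zero |>.1 h3)

end Volumes

/-! ### The remainder of the linear expansion -/

/-- Second-order estimate for the linearisation of `z = x / √s` at `(x, s) = (a, 1)`. With
`r = √s` the remainder equals `(1 - r) (x - a) + (1 - r)² (z + a / 2)`, and the a priori bound on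
`z` makes the estimate valid for every `s ≥ 0`, however small. -/
lemma abs_linear_remainder_le {a κ x s z : ℝ} (ha : 0 ≤ a) (hs : 0 ≤ s) (hz0 : 0 ≤ z) (hz : z ≤ κ)
    (hx : x = √s * z) :
    |z - x + a / 2 * (s - 1)| ≤ (1 + κ + a / 2) * ((x - a) ^ 2 + (s - 1) ^ 2) := by
  set r := √s with hr
  have hr0 : 0 ≤ r := Real.sqrt_nonneg s
  have hrs : r ^ 2 = s := Real.sq_sqrt hs
  have h1 : |1 - r| ≤ |s - 1| := by
    rw [← hrs, show r ^ 2 - 1 = -((1 - r) * (1 + r)) by ring, abs_neg, abs_mul,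
      abs_of_nonneg (by linarith : 0 ≤ 1 + r)]
    exact le_mul_of_one_le_right (abs_nonneg _) (by linarith)
  have h2 : (1 - r) ^ 2 ≤ (s - 1) ^ 2 := sq_le_sq.2 h1
  have h3 : |1 - r| * |x - a| ≤ (x - a) ^ 2 + (s - 1) ^ 2 := by
    have := mul_le_mul_of_nonneg_right h1 (abs_nonneg (x - a))
    nlinarith [sq_abs (x - a), sq_abs (s - 1), sq_nonneg (|s - 1| - |x - a|)]
  have h4 : (1 - r) ^ 2 * (z + a / 2) ≤ (s - 1) ^ 2 * (κ + a / 2) :=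
    mul_le_mul h2 (by linarith) (by positivity) (sq_nonneg _)
  have hR : z - x + a / 2 * (s - 1) = (1 - r) * (x - a) + (1 - r) ^ 2 * (z + a / 2) := by
    rw [← hrs, hx]
    ring
  rw [hR]
  refine (abs_add_le _ _).trans ?_
  rw [abs_mul (1 - r) (x - a), abs_of_nonneg (by positivity : 0 ≤ (1 - r) ^ 2 * (z + a / 2))]
  nlinarith [mul_nonneg (by linarith : 0 ≤ κ + a / 2) (sq_nonneg (x - a))]

/-- The coefficient `2^{n-1} Δ_{n,1} / Δ_{n,2}^2` of `Y_N^2`. -/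
noncomputable def gramCoeff (n : ℕ) : ℝ := 2 ^ (n - 1) * gaussDet n 1 / gaussDet n 2 ^ 2

lemma gaussDet_one (n : ℕ) : gaussDet n 1 =
    ∫ v, |colDet v| ∂(Measure.pi fun _ : Fin n => stdGaussian (EuclideanSpace ℝ (Fin n))) := by
  simp only [gaussDet, Real.rpow_one, div_one]
  rfl

lemma gaussDet_two_sq (n : ℕ) : gaussDet n 2 ^ 2 = n.factorial := by
  rw [← integral_colDet_sq, gaussDet, ← Real.sqrt_eq_rpow, Real.sq_sqrt]
  · refine integral_congr_ae (ae_of_all _ fun v => ?_)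
    simp only [Real.rpow_ofNat, sq_abs]
    rfl
  · exact integral_nonneg fun v => Real.rpow_nonneg (abs_nonneg _) _

lemma gaussDet_one_nonneg (n : ℕ) : 0 ≤ gaussDet n 1 := by
  rw [gaussDet_one]
  exact integral_nonneg fun _ => abs_nonneg _

lemma gramCoeff_eq {n : ℕ} (hn : 1 ≤ n) :
    gramCoeff n = 2 ^ n / n.factorial * gaussDet n 1 / 2 := by
  obtain ⟨m, rfl⟩ := Nat.exists_eq_add_of_le' hn
  rw [gramCoeff, gaussDet_two_sq, Nat.add_sub_cancel, pow_succ]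
  ring

section Remainder

variable {n : ℕ} {Ω : Type*}

/-- The remainder of the normalised volume `Z_N / N^{n/2}` in its linear expansion in terms of
`X_N / N^n` and `Y_N^2 / N^n`. -/
noncomputable def remainder (g : ℕ → Ω → EuclideanSpace ℝ (Fin n)) (N : ℕ) (ω : Ω) : ℝ :=
  ZN g N ω / √N ^ n - XN g N ω / N ^ n + gramCoeff n * (YN g N ω ^ 2 / N ^ n - 1)

variable {g : ℕ → Ω → EuclideanSpace ℝ (Fin n)}

lemma XN_div_pow {N : ℕ} (hN : 1 ≤ N) (ω : Ω) : XN g N ω / N ^ n =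
    2 ^ n / n.factorial * tupleAverage (fun v => |colDet v|) g N ω := by
  have hN0 : (N : ℝ) ≠ 0 := by exact_mod_cast (by omega : N ≠ 0)
  rw [XN_eq_tupleAverage g hN, mul_div_cancel_left₀ _ (by positivity)]

lemma YN_sq_div_pow {N : ℕ} (hN : 1 ≤ N) (ω : Ω) : YN g N ω ^ 2 / N ^ n =
    1 / n.factorial * tupleAverage (fun v => colDet v ^ 2) g N ω := by
  have hN0 : (N : ℝ) ≠ 0 := by exact_mod_cast (by omega : N ≠ 0)
  rw [YN_sq_eq_tupleAverage g hN, mul_div_cancel_left₀ _ (by positivity)]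

lemma ZN_nonneg (N : ℕ) (ω : Ω) : 0 ≤ ZN g N ω := ENNReal.toReal_nonneg

lemma YN_nonneg (N : ℕ) (ω : Ω) : 0 ≤ YN g N ω := Real.sqrt_nonneg _

variable [MeasurableSpace Ω] {μ : Measure Ω}

lemma ae_XN_eq_mul (hlaw : ∀ i, HasLaw (g i) (stdGaussian (EuclideanSpace ℝ (Fin n))) μ)
    (hind : iIndepFun g μ) {N : ℕ} (hN : n ≤ N) :
    ∀ᵐ ω ∂μ, XN g N ω = YN g N ω * ZN g N ω ∧ YN g N ω ≠ 0 := by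
  filter_upwards [ae_det_gram_ne_zero hlaw hind hN] with ω hω
  refine ⟨imageVolume_eq_mul _ hω, ?_⟩
  have : YN g N ω ^ 2 ≠ 0 := by
    unfold YN
    rwa [gramRoot_sq]
  exact fun h => this (by rw [h]; simp)

lemma ae_ZN_le (hn : 1 ≤ n) (hlaw : ∀ i, HasLaw (g i) (stdGaussian (EuclideanSpace ℝ (Fin n))) μ)
    (hind : iIndepFun g μ) {N : ℕ} (hN : n ≤ N) :
    ∀ᵐ ω ∂μ, ZN g N ω ≤ √N ^ n * (√Real.pi ^ n / Real.Gamma (n / 2 + 1)) := by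
  filter_upwards [ae_det_gram_ne_zero hlaw hind hN] with ω hω
  exact projectionVolume_le hn _ (finrank_rowSpace _ hω)

lemma memLp_XN (hn : 1 ≤ n) (hlaw : ∀ i, HasLaw (g i) (stdGaussian (EuclideanSpace ℝ (Fin n))) μ)
    (hind : iIndepFun g μ) {N : ℕ} (hN : n ≤ N) (q : ℕ) : MemLp (XN g N) q μ := by
  have h := (memLp_tupleAverage (fun q => (memLp_colDet n q).norm)
    (fun v hv => by simp [colDet_eq_zero_of_not_injective hv]) hlaw hind N q).const_mul
      ((N : ℝ) ^ n * (2 ^ n / n.factorial))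
  refine h.ae_eq (ae_of_all _ fun ω => ?_)
  rw [XN_eq_tupleAverage g (hn.trans hN)]
  exact mul_assoc _ _ _

lemma memLp_YN_sq (hn : 1 ≤ n) (hlaw : ∀ i, HasLaw (g i) (stdGaussian (EuclideanSpace ℝ (Fin n))) μ)
    (hind : iIndepFun g μ) {N : ℕ} (hN : n ≤ N) (q : ℕ) : MemLp (fun ω => YN g N ω ^ 2) q μ := by
  have h := (memLp_tupleAverage (memLp_colDet_sq n)
    (fun v hv => by simp [colDet_eq_zero_of_not_injective hv]) hlaw hind N q).const_mul
      ((N : ℝ) ^ n * (1 / n.factorial))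
  refine h.ae_eq (ae_of_all _ fun ω => ?_)
  beta_reduce
  rw [YN_sq_eq_tupleAverage g (hn.trans hN)]
  exact mul_assoc _ _ _

lemma memLp_ZN [IsFiniteMeasure μ] (hn : 1 ≤ n)
    (hlaw : ∀ i, HasLaw (g i) (stdGaussian (EuclideanSpace ℝ (Fin n))) μ)
    (hind : iIndepFun g μ) {N : ℕ} (hN : n ≤ N) (q : ℕ) : MemLp (ZN g N) q μ := by
  have hX : AEMeasurable (XN g N) μ := (memLp_XN hn hlaw hind hN 1).1.aemeasurable
  have hY : AEMeasurable (YN g N) μ := by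
    have := (memLp_YN_sq hn hlaw hind hN 1).1.aemeasurable.sqrt
    simpa [Real.sqrt_sq (YN_nonneg N _)] using this
  have hZ : AEMeasurable (ZN g N) μ := by
    refine (hX.div hY).congr ?_
    filter_upwards [ae_XN_eq_mul hlaw hind hN] with ω hω
    simp only [Pi.div_apply]
    rw [hω.1, mul_div_cancel_left₀ _ hω.2]
  refine MemLp.of_bound hZ.aestronglyMeasurable
    (√N ^ n * (√Real.pi ^ n / Real.Gamma (n / 2 + 1))) ?_
  filter_upwards [ae_ZN_le hn hlaw hind hN] with ω hω
  rwa [Real.norm_eq_abs, abs_of_nonneg (ZN_nonneg N ω)]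

lemma memLp_remainder [IsFiniteMeasure μ] (hn : 1 ≤ n)
    (hlaw : ∀ i, HasLaw (g i) (stdGaussian (EuclideanSpace ℝ (Fin n))) μ)
    (hind : iIndepFun g μ) {N : ℕ} (hN : n ≤ N) (q : ℕ) : MemLp (remainder g N) q μ := by
  unfold remainder
  simp_rw [div_eq_mul_inv]
  exact (((memLp_ZN hn hlaw hind hN q).mul_const _).sub
    ((memLp_XN hn hlaw hind hN q).mul_const _)).add
    ((((memLp_YN_sq hn hlaw hind hN q).mul_const _).sub (memLp_const 1)).const_mul _)

lemma ae_abs_remainder_le (hn : 1 ≤ n)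
    (hlaw : ∀ i, HasLaw (g i) (stdGaussian (EuclideanSpace ℝ (Fin n))) μ)
    (hind : iIndepFun g μ) {N : ℕ} (hN : n ≤ N) :
    ∀ᵐ ω ∂μ, |remainder g N ω| ≤
      (1 + √Real.pi ^ n / Real.Gamma (n / 2 + 1) + 2 ^ n / n.factorial * gaussDet n 1 / 2) *
        ((2 ^ n / n.factorial * (tupleAverage (fun v => |colDet v|) g N ω - gaussDet n 1)) ^ 2 +
          (1 / n.factorial * (tupleAverage (fun v => colDet v ^ 2) g N ω - n.factorial)) ^ 2) := by
  have hN1 := hn.trans hN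
  have hN0 : (0 : ℝ) < N := by exact_mod_cast hN1
  filter_upwards [ae_XN_eq_mul hlaw hind hN, ae_ZN_le hn hlaw hind hN] with ω h1 h2
  have hpow : (N : ℝ) ^ n = √N ^ n * √N ^ n := by
    rw [← mul_pow, Real.mul_self_sqrt hN0.le]
  have hpos : 0 < √(N : ℝ) ^ n := pow_pos (Real.sqrt_pos.2 hN0) n
  have hx : XN g N ω / N ^ n = √(YN g N ω ^ 2 / N ^ n) * (ZN g N ω / √N ^ n) := by
    rw [h1.1, Real.sqrt_div (sq_nonneg _), Real.sqrt_sq (YN_nonneg N ω), hpow,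
      Real.sqrt_mul_self hpos.le]
    field_simp
  have key := abs_linear_remainder_le (a := 2 ^ n / n.factorial * gaussDet n 1)
    (mul_nonneg (by positivity) (gaussDet_one_nonneg n))
    (div_nonneg (sq_nonneg (YN g N ω)) (by positivity))
    (div_nonneg (ZN_nonneg N ω) hpos.le) ((div_le_iff₀' hpos).2 h2) hx
  rw [← gramCoeff_eq hn] at key
  rw [← gramCoeff_eq hn]
  refine key.trans_eq ?_
  rw [XN_div_pow hN1, YN_sq_div_pow hN1]
  have : (n.factorial : ℝ) ≠ 0 := by positivity
  congr 3
  · ring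
  · field_simp

end Remainder

/-- The remainder is `O(1/N)` in every `L^{2k}`. -/
theorem exists_moment_remainder_le {n : ℕ} (hn : 1 ≤ n) (k : ℕ) :
    ∃ C : ℝ, 0 ≤ C ∧ ∀ {Ω : Type*} [MeasurableSpace Ω] (μ : Measure Ω) [IsProbabilityMeasure μ]
      (g : ℕ → Ω → EuclideanSpace ℝ (Fin n)),
      (∀ i, HasLaw (g i) (stdGaussian (EuclideanSpace ℝ (Fin n))) μ) → iIndepFun g μ →
      ∀ N : ℕ, n ≤ N → ∫ ω, remainder g N ω ^ (2 * k) ∂μ ≤ C / N ^ (2 * k) := by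
  obtain ⟨C₁, hC₁0, hC₁⟩ := exists_moment_tupleAverage_le
    (stdGaussian (EuclideanSpace ℝ (Fin n))) hn (h := fun v => |colDet v|)
    (continuous_colDet n).abs.measurable (fun q => (memLp_colDet n q).norm)
    (fun v hv => by simp [colDet_eq_zero_of_not_injective hv]) (2 * k)
  obtain ⟨C₂, hC₂0, hC₂⟩ := exists_moment_tupleAverage_le
    (stdGaussian (EuclideanSpace ℝ (Fin n))) hn (h := fun v => colDet v ^ 2)
    ((continuous_colDet n).pow 2).measurable (memLp_colDet_sq n)
    (fun v hv => by simp [colDet_eq_zero_of_not_injective hv]) (2 * k)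
  set K := 1 + √Real.pi ^ n / Real.Gamma (n / 2 + 1) + 2 ^ n / n.factorial * gaussDet n 1 / 2
  set c₁ : ℝ := 2 ^ n / n.factorial
  set c₂ : ℝ := 1 / n.factorial
  refine ⟨K ^ (2 * k) * (4 ^ k * (c₁ ^ (2 * (2 * k)) * C₁ + c₂ ^ (2 * (2 * k)) * C₂)), ?_, ?_⟩
  · have : 0 ≤ K ^ (2 * k) := by rw [pow_mul]; positivity
    positivity
  intro Ω _ μ _ g hlaw hind N hN
  have hK0 : 0 ≤ K ^ (2 * k) := by rw [pow_mul]; positivity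
  have h1 := hC₁ μ g hlaw hind N hN
  have h2 := hC₂ μ g hlaw hind N hN
  rw [← gaussDet_one] at h1
  rw [integral_colDet_sq] at h2
  set U : Ω → ℝ := fun ω => tupleAverage (fun v => |colDet v|) g N ω - gaussDet n 1
  set V : Ω → ℝ := fun ω => tupleAverage (fun v => colDet v ^ 2) g N ω - n.factorial
  have hU : Integrable (fun ω => U ω ^ (2 * (2 * k))) μ :=
    MemLp.integrable_pow_nat (fun q => (memLp_tupleAverage (fun q => (memLp_colDet n q).norm)
      (fun v hv => by simp [colDet_eq_zero_of_not_injective hv]) hlaw hind N q).sub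
      (memLp_const _)) _
  have hV : Integrable (fun ω => V ω ^ (2 * (2 * k))) μ :=
    MemLp.integrable_pow_nat (fun q => (memLp_tupleAverage (memLp_colDet_sq n)
      (fun v hv => by simp [colDet_eq_zero_of_not_injective hv]) hlaw hind N q).sub
      (memLp_const _)) _
  have hUV := (((hU.const_mul (c₁ ^ (2 * (2 * k)))).add (hV.const_mul (c₂ ^ (2 * (2 * k))))).const_mul
    ((4 : ℝ) ^ k)).const_mul (K ^ (2 * k))
  calc ∫ ω, remainder g N ω ^ (2 * k) ∂μ
      ≤ ∫ ω, K ^ (2 * k) * (4 ^ k * (c₁ ^ (2 * (2 * k)) * U ω ^ (2 * (2 * k)) +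
          c₂ ^ (2 * (2 * k)) * V ω ^ (2 * (2 * k)))) ∂μ := by
        refine integral_mono_ae
          (MemLp.integrable_pow_nat (fun q => memLp_remainder hn hlaw hind hN q) _) hUV ?_
        filter_upwards [ae_abs_remainder_le hn hlaw hind hN] with ω hω
        rw [← (even_two_mul k).pow_abs]
        refine (pow_le_pow_left₀ (abs_nonneg _) hω _).trans ?_
        rw [mul_pow]
        refine mul_le_mul_of_nonneg_left ((add_pow_two_mul_le k _ _).trans_eq ?_) hK0
        rw [← pow_mul, ← pow_mul, mul_pow, mul_pow]
    _ = K ^ (2 * k) * (4 ^ k * (c₁ ^ (2 * (2 * k)) * (∫ ω, U ω ^ (2 * (2 * k)) ∂μ) +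
          c₂ ^ (2 * (2 * k)) * ∫ ω, V ω ^ (2 * (2 * k)) ∂μ)) := by
        rw [integral_const_mul, integral_const_mul, integral_add (hU.const_mul _) (hV.const_mul _),
          integral_const_mul, integral_const_mul]
    _ ≤ K ^ (2 * k) * (4 ^ k * (c₁ ^ (2 * (2 * k)) * (C₁ / N ^ (2 * k)) +
          c₂ ^ (2 * (2 * k)) * (C₂ / N ^ (2 * k)))) := by
        gcongr
    _ = _ := by ring

/-- Jensen's inequality for the centring of a random variable. -/
lemma integral_centred_pow_le {Ω : Type*} [MeasurableSpace Ω] {μ : Measure Ω}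
    [IsProbabilityMeasure μ] {f : Ω → ℝ} (hf : ∀ q : ℕ, MemLp f q μ) (k : ℕ) :
    ∫ ω, ((∫ ω', f ω' ∂μ) - f ω) ^ (2 * k) ∂μ ≤ 2 * 4 ^ k * ∫ ω, f ω ^ (2 * k) ∂μ := by
  have hint := MemLp.integrable_pow_nat hf (2 * k)
  have hjensen : (∫ ω, f ω ∂μ) ^ (2 * k) ≤ ∫ ω, f ω ^ (2 * k) ∂μ :=
    (even_two_mul k).convexOn_pow.map_integral_le (by fun_prop) isClosed_univ (by simp)
      ((hf 1).integrable (by simp)) hint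
  calc ∫ ω, ((∫ ω', f ω' ∂μ) - f ω) ^ (2 * k) ∂μ
      ≤ ∫ ω, 4 ^ k * ((∫ ω', f ω' ∂μ) ^ (2 * k) + f ω ^ (2 * k)) ∂μ := by
        refine integral_mono (MemLp.integrable_pow_nat (fun q => (memLp_const _).sub (hf q)) _)
          (((integrable_const _).add hint).const_mul _) fun ω => ?_
        have := add_pow_two_mul_le k (∫ ω', f ω' ∂μ) (-f ω)
        rwa [(even_two_mul k).neg_pow, ← sub_eq_add_neg] at this
    _ = 4 ^ k * ((∫ ω, f ω ∂μ) ^ (2 * k) + ∫ ω, f ω ^ (2 * k) ∂μ) := by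
        rw [integral_const_mul, integral_add (integrable_const _) hint]
        simp
    _ ≤ 4 ^ k * ((∫ ω, f ω ^ (2 * k) ∂μ) + ∫ ω, f ω ^ (2 * k) ∂μ) := by gcongr
    _ = _ := by ring

/-- A sequence with summable fourth moments tends to zero almost surely. -/
lemma ae_tendsto_zero_of_summable_moment {Ω : Type*} [MeasurableSpace Ω] {μ : Measure Ω}
    {f : ℕ → Ω → ℝ} {c : ℕ → ℝ} (hint : ∀ m, Integrable (fun ω => f m ω ^ 4) μ)
    (hc : Summable c) (hle : ∀ m, ∫ ω, f m ω ^ 4 ∂μ ≤ c m) :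
    ∀ᵐ ω ∂μ, Tendsto (fun m => f m ω) atTop (𝓝 0) := by
  have hpos : ∀ m ω, 0 ≤ f m ω ^ 4 := fun m ω => (show Even 4 by decide).pow_nonneg _
  have hfin : ∫⁻ ω, ∑' m, ENNReal.ofReal (f m ω ^ 4) ∂μ ≠ ⊤ := by
    rw [lintegral_tsum fun m => (hint m).1.aemeasurable.ennreal_ofReal]
    refine ne_top_of_le_ne_top hc.tsum_ofReal_ne_top (ENNReal.tsum_le_tsum fun m => ?_)
    rw [← ofReal_integral_eq_lintegral_ofReal (hint m) (ae_of_all _ (hpos m))]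
    exact ENNReal.ofReal_le_ofReal (hle m)
  have hmeas : AEMeasurable (fun ω => ∑' m, ENNReal.ofReal (f m ω ^ 4)) μ :=
    AEMeasurable.tsum fun m => (hint m).1.aemeasurable.ennreal_ofReal
  filter_upwards [ae_lt_top' hmeas hfin] with ω hω
  have h1 := ENNReal.tendsto_atTop_zero_of_tsum_ne_top hω.ne
  have h2 := (ENNReal.tendsto_toReal ENNReal.zero_ne_top).comp h1
  have h3 : Tendsto (fun m => f m ω ^ 4) atTop (𝓝 0) := by
    simpa [Function.comp_def, ENNReal.toReal_ofReal (hpos _ ω)] using h2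
  rw [tendsto_zero_iff_abs_tendsto_zero]
  have h4 := (h3.sqrt).sqrt
  simp only [Real.sqrt_zero] at h4
  refine h4.congr fun m => ?_
  rw [show f m ω ^ 4 = (f m ω ^ 2) ^ 2 by ring, Real.sqrt_sq (sq_nonneg _), Real.sqrt_sq_eq_abs]
  rfl

theorem proposition4p4 (n : ℕ) (hn : 1 ≤ n) :
    -- the constants `C p = C_{n,p}` depend on `n` and `p` only
    ∃ C : ℝ → ℝ,
      ∀ {Ω : Type*} [MeasurableSpace Ω] (μ : Measure Ω) [IsProbabilityMeasure μ]
        (g : ℕ → Ω → EuclideanSpace ℝ (Fin n)),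
        (∀ i, HasLaw (g i) (stdGaussian (EuclideanSpace ℝ (Fin n))) μ) →
        iIndepFun g μ →
        -- the expectations in the expansion exist
        (∀ N, n ≤ N → Integrable (XN g N) μ ∧ Integrable (fun ω => YN g N ω ^ 2) μ ∧
          Integrable (ZN g N) μ) ∧
        ∃ α β δ : ℕ → Ω → ℝ,
          (∀ N, n ≤ N → AEMeasurable (α N) μ ∧ AEMeasurable (β N) μ ∧ AEMeasurable (δ N) μ) ∧
          (∀ N, n ≤ N → ∀ᵐ ω ∂μ,
            (ZN g N ω - ∫ ω', ZN g N ω' ∂μ) / (N : ℝ) ^ (((n : ℝ) - 1) / 2) =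
              α N ω * ((XN g N ω - ∫ ω', XN g N ω' ∂μ) / (N : ℝ) ^ ((n : ℝ) - 1 / 2))
              - β N ω * ((YN g N ω ^ 2 - ∫ ω', YN g N ω' ^ 2 ∂μ) / (N : ℝ) ^ ((n : ℝ) - 1 / 2))
              - δ N ω) ∧
          (∀ᵐ ω ∂μ, Tendsto (fun N => α N ω) atTop (𝓝 1)) ∧
          (∀ᵐ ω ∂μ, Tendsto (fun N => β N ω) atTop
            (𝓝 (2 ^ (n - 1) * gaussDet n 1 / gaussDet n 2 ^ 2))) ∧
          (∀ᵐ ω ∂μ, Tendsto (fun N => δ N ω) atTop (𝓝 0)) ∧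
          ∀ p : ℝ, 1 ≤ p → ∀ N : ℕ, (n : ℝ) + 4 * p - 1 ≤ N →
            (Integrable (fun ω => |α N ω| ^ p) μ ∧ ∫ ω, |α N ω| ^ p ∂μ ≤ C p) ∧
            (Integrable (fun ω => |β N ω| ^ p) μ ∧ ∫ ω, |β N ω| ^ p ∂μ ≤ C p) ∧
            (Integrable (fun ω => |δ N ω| ^ p) μ ∧ ∫ ω, |δ N ω| ^ p ∂μ ≤ C p) := by
  choose C hC0 hC using fun k => exists_moment_remainder_le hn k
  refine ⟨fun p => 1 + |gramCoeff n| ^ p + 2 * 4 ^ ⌈p⌉₊ * C ⌈p⌉₊, ?_⟩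
  intro Ω _ μ _ g hlaw hind
  have hX := fun N (hN : n ≤ N) => (memLp_XN hn hlaw hind hN 1).integrable (by simp)
  have hY := fun N (hN : n ≤ N) => (memLp_YN_sq hn hlaw hind hN 1).integrable (by simp)
  have hZ := fun N (hN : n ≤ N) => (memLp_ZN hn hlaw hind hN 1).integrable (by simp)
  refine ⟨fun N hN => ⟨hX N hN, hY N hN, hZ N hN⟩, ?_⟩
  set δ : ℕ → Ω → ℝ := fun N ω => √N * ((∫ ω', remainder g N ω' ∂μ) - remainder g N ω) with hδ
  have hδLp : ∀ N, n ≤ N → ∀ q : ℕ, MemLp (δ N) q μ := fun N hN q =>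
    ((memLp_const _).sub (memLp_remainder hn hlaw hind hN q)).const_mul _
  -- each central moment of the remainder gains the factor `N^{-2k}`, of which `√N` uses up `N^k`
  have hδmom : ∀ N, n ≤ N → ∀ k : ℕ, ∫ ω, δ N ω ^ (2 * k) ∂μ ≤ 2 * 4 ^ k * C k / N ^ k := by
    intro N hN k
    have hN0 : (0 : ℝ) < N := by exact_mod_cast hn.trans hN
    simp_rw [hδ, mul_pow]
    rw [integral_const_mul, pow_mul, Real.sq_sqrt hN0.le]
    calc _ ≤ (N : ℝ) ^ k * (2 * 4 ^ k * (C k / N ^ (2 * k))) := by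
          gcongr
          refine (integral_centred_pow_le (memLp_remainder hn hlaw hind hN) k).trans ?_
          gcongr
          exact hC k μ g hlaw hind N hN
      _ = _ := by
          rw [two_mul k, pow_add]
          field_simp
  -- constant coefficients; `δ` is the centred remainder
  refine ⟨fun _ _ => 1, fun _ _ => gramCoeff n, δ, fun N hN => ⟨aemeasurable_const,
    aemeasurable_const, (hδLp N hN 1).1.aemeasurable⟩, fun N hN => ae_of_all _ fun ω => ?_,
    ae_of_all _ fun _ => tendsto_const_nhds, ae_of_all _ fun _ => tendsto_const_nhds, ?_, ?_⟩
  · have hN0 : (0 : ℝ) < N := by exact_mod_cast hn.trans hN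
    have hs : 0 < √(N : ℝ) := Real.sqrt_pos.2 hN0
    have h1 : (N : ℝ) ^ (((n : ℝ) - 1) / 2) = √N ^ n / √N := by
      rw [sub_div, Real.rpow_sub hN0, ← Real.sqrt_eq_rpow, Real.sqrt_eq_rpow, ← Real.rpow_natCast,
        ← Real.rpow_mul hN0.le]
      congr 2
      ring
    have h2 : (N : ℝ) ^ ((n : ℝ) - 1 / 2) = N ^ n / √N := by
      rw [Real.rpow_sub hN0, ← Real.sqrt_eq_rpow, Real.rpow_natCast]
    have hint : ∫ ω', remainder g N ω' ∂μ = (∫ ω', ZN g N ω' ∂μ) / √N ^ n -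
        (∫ ω', XN g N ω' ∂μ) / N ^ n +
        gramCoeff n * ((∫ ω', YN g N ω' ^ 2 ∂μ) / N ^ n - 1) := by
      have hZX : Integrable (fun ω => ZN g N ω / √N ^ n - XN g N ω / N ^ n) μ :=
        ((hZ N hN).div_const _).sub ((hX N hN).div_const _)
      have hY1 : Integrable (fun ω => YN g N ω ^ 2 / (N : ℝ) ^ n - 1) μ :=
        ((hY N hN).div_const _).sub (integrable_const 1)
      unfold remainder
      rw [integral_add hZX (hY1.const_mul _),
        integral_sub ((hZ N hN).div_const _) ((hX N hN).div_const _), integral_const_mul,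
        integral_sub ((hY N hN).div_const _) (integrable_const 1), integral_div, integral_div,
        integral_div]
      simp
    simp only [hδ]
    rw [hint, h1, h2, remainder]
    field_simp
    ring
  · have hae := ae_tendsto_zero_of_summable_moment (μ := μ) (f := fun m => δ (m + n))
      (c := fun m => 2 * 4 ^ 2 * C 2 * (1 / ((m + n : ℕ) : ℝ) ^ 2))
      (fun m => MemLp.integrable_pow_nat (hδLp (m + n) (by omega)) 4)
      (((summable_nat_add_iff n).2 (Real.summable_one_div_nat_pow.2 one_lt_two)).mul_left _)
      (fun m => (hδmom (m + n) (by omega) 2).trans_eq (by ring))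
    filter_upwards [hae] with ω hω
    exact (tendsto_add_atTop_iff_nat n).1 hω
  · intro p hp N hpN
    have hN : n ≤ N := by
      have : (n : ℝ) ≤ N := by linarith
      exact_mod_cast this
    have hN1 : (1 : ℝ) ≤ N := by exact_mod_cast hn.trans hN
    have hb : 0 ≤ |gramCoeff n| ^ p := Real.rpow_nonneg (abs_nonneg _) p
    have hCp : 0 ≤ 2 * 4 ^ ⌈p⌉₊ * C ⌈p⌉₊ := mul_nonneg (by positivity) (hC0 _)
    refine ⟨⟨integrable_const _, ?_⟩, ⟨integrable_const _, ?_⟩, ?_⟩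
    · simp
      linarith
    · simp
      linarith
    have hbound : ∀ ω, |δ N ω| ^ p ≤ 1 + δ N ω ^ (2 * ⌈p⌉₊) := by
      intro ω
      rcases le_total |δ N ω| 1 with h | h
      · have h1 : |δ N ω| ^ p ≤ 1 := Real.rpow_le_one (abs_nonneg _) h (by linarith)
        have h2 : 0 ≤ δ N ω ^ (2 * ⌈p⌉₊) := (even_two_mul _).pow_nonneg _
        linarith
      · have h1 : |δ N ω| ^ p ≤ |δ N ω| ^ ((2 * ⌈p⌉₊ : ℕ) : ℝ) := by
          refine Real.rpow_le_rpow_of_exponent_le h ?_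
          push_cast
          linarith [Nat.le_ceil p]
        rw [Real.rpow_natCast, (even_two_mul _).pow_abs] at h1
        linarith
    have hmom := MemLp.integrable_pow_nat (hδLp N hN) (2 * ⌈p⌉₊)
    have hint : Integrable (fun ω => |δ N ω| ^ p) μ := by
      refine ((integrable_const 1).add hmom).mono'
        ((hδLp N hN 1).1.aemeasurable.abs.pow_const p).aestronglyMeasurable
        (ae_of_all _ fun ω => ?_)
      rw [Real.norm_eq_abs, abs_of_nonneg (Real.rpow_nonneg (abs_nonneg _) p)]
      exact hbound ω
    refine ⟨hint, ?_⟩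
    calc ∫ ω, |δ N ω| ^ p ∂μ ≤ ∫ ω, (1 + δ N ω ^ (2 * ⌈p⌉₊)) ∂μ :=
          integral_mono hint ((integrable_const 1).add hmom) hbound
      _ = 1 + ∫ ω, δ N ω ^ (2 * ⌈p⌉₊) ∂μ := by
          rw [integral_add (integrable_const 1) hmom]
          simp
      _ ≤ 1 + 2 * 4 ^ ⌈p⌉₊ * C ⌈p⌉₊ := by
          gcongr
          refine (hδmom N hN _).trans (div_le_self hCp (one_le_pow₀ hN1))
      _ ≤ _ := by linarith
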